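/- All graded rings are commutative and graded by the multiplicative group $\Gamma=\mathbb{R}_{+}^{\times}$ of positive real numbers; a graded field is a nonzero graded ring in which every nonzero homogeneous element is invertible. Let $k$ be a graded field whose subring $k_1$ of homogeneous elements of degree $1$ (a field) has characteristic $p>0$, let $\bar k$ be a graded algebraic closure of $k$ (an extension of graded fields whose homogeneous elements are algebraic over $k$, and in which, for every $r\in\Gamma$, every homogeneous polynomial of positive monomial degree in $\bar k[T]$, with $T$ placed in degree $r$, has a root homogeneous of degree $r$). Let $n\ge 1$ and let $\ell=k^{p^{-n}}=\{x\in\bar k : x^{p^n}\in k\}$, with the grading induced from $\bar k$. Let $k_1[F]$ be the noncommutative polynomial ring with the relations $Fa=a^pF$ for $a\in k_1$ (the endomorphism ring of the additive group $\mathbb{G}_{a,k_1}$). For $\tau=\sum_i a_iF^i\in k_1[F]$ put $\tau(T)=\sum_i a_iT^{p^i}$ and $\tau^{(n)}=\sum_i a_i^{p^n}F^i$, and let $k_1[F]^{(n)}=\{\sigma^{(n)} : \sigma\in k_1[F]\}$. Let $B=k[T]$ with $T$ of degree $1$. The $p$-polynomials $f(T)=a_0T+a_1T^p+\dots+a_mT^{p^m}\in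 k[T]$ that are homogeneous of degree $1$ and have $a_0\neq 0$ are exactly the polynomials $\tau(T)$ with $\tau\in k_1[F]$ and $a_0\ne 0$, for a unique such $\tau$. For every such $f=\tau(T)$ let $$A(\tau):=k[T_1,T_2]/(T_2^{p^n}-f(T_1)),$$ with $T_1,T_2$ of degree $1$ and with the comultiplication $T_i\mapsto T_i\otimes 1+1\otimes T_i$, counit $T_i\mapsto 0$ and antipode $T_i\mapsto -T_i$. Then: 1. $A(\tau)$ is a graded Hopf algebra over $k$ (a graded $k$-algebra and a Hopf algebra whose comultiplication, counit and antipode are graded of degree $1$). 2. $A(\tau)$ is a graded form of $B$ with respect to $\ell/k$, i.e. $\ell\otimes_kA(\tau)$ and $\ell\otimes_kB$ are isomorphic as graded $\ell$-algebras (by an isomorphism of degree $1$). 3. The form $A(\tau)$ is trivial, i.e. isomorphic to $B$ as a graded $k$-algebra, if and only if $\tau c\in k_1[F]^{(n)}$ for some $c\in k_1^\times$. 4. $k_1$ is perfect if and only if $A(\tau)$ is trivial for all $\tau\in k_1[F]$ with $a_0\neq 0$. -/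

import Mathlib

open scoped TensorProduct

/-! ### Gradings

The grading group is the multiplicative group of positive real numbers.  Mathlib indexes gradings
additively, so it is written additively: the degree `1` is `(0 : GradingGroup)`, the product of two
degrees is their sum and `r ^ i` is `i • r`. -/

/-- The group of positive reals, in additive notation. -/
abbrev GradingGroup : Type := Additive {r : ℝ // 0 < r}

/-- A graded field: a nonzero graded ring in which every nonzero homogeneous element is
invertible. -/
structure IsGradedField {k : Type*} [CommRing k] (𝒦 : GradingGroup → AddSubgroup k)
    [GradedRing 𝒦] : Prop where
  nontrivial : Nontrivial k
  isUnit : ∀ γ, ∀ a ∈ 𝒦 γ, a ≠ 0 → IsUnit a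

/-- The subring `A_1` of homogeneous elements of degree `1` of a graded ring `A`. -/
abbrev degreeOne {k : Type*} [CommRing k] (𝒦 : GradingGroup → AddSubgroup k) [GradedRing 𝒦] :
    Subring k :=
  SetLike.GradeZero.subring 𝒦

/-- The grading of the polynomial ring `R[r⁻¹T]`: the piece of degree `γ` consists of the
`∑ aᵢ Tⁱ` with `aᵢ` homogeneous of degree `γ r⁻ⁱ`. -/
def polyGrading {R : Type*} [CommRing R] (ℛ : GradingGroup → AddSubgroup R) (r : GradingGroup)
    (γ : GradingGroup) : AddSubgroup (Polynomial R) where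
  carrier := {f | ∀ i, f.coeff i ∈ ℛ (γ - i • r)}
  add_mem' hf hg i := by
    rw [Polynomial.coeff_add]; exact add_mem (hf i) (hg i)
  zero_mem' i := by
    rw [Polynomial.coeff_zero]; exact zero_mem _
  neg_mem' hf i := by
    rw [Polynomial.coeff_neg]; exact neg_mem (hf i)

/-- The grading of the polynomial ring `R[T₁, T₂]` in which both variables have degree `1`: the
piece of degree `γ` consists of the polynomials with coefficients homogeneous of degree `γ`. -/
def planeGrading {R : Type*} [CommRing R] (ℛ : GradingGroup → AddSubgroup R)
    (γ : GradingGroup) : AddSubgroup (MvPolynomial (Fin 2) R) where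
  carrier := {f | ∀ d, f.coeff d ∈ ℛ γ}
  add_mem' hf hg d := by
    rw [MvPolynomial.coeff_add]; exact add_mem (hf d) (hg d)
  zero_mem' d := by
    rw [MvPolynomial.coeff_zero]; exact zero_mem _
  neg_mem' hf d := by
    rw [MvPolynomial.coeff_neg]; exact neg_mem (hf d)

/-- The tensor product grading: `(M ⊗ N)_γ` is the sum of the `M_δ ⊗ N_ε` with `δ ε = γ`. -/
def tensorGrading {R M N : Type*} [CommRing R] [AddCommGroup M] [AddCommGroup N]
    [Module R M] [Module R N] (ℳ : GradingGroup → AddSubgroup M)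
    (𝒩 : GradingGroup → AddSubgroup N) (γ : GradingGroup) : AddSubgroup (M ⊗[R] N) :=
  AddSubgroup.closure
    {z | ∃ δ ε, δ + ε = γ ∧ ∃ x ∈ ℳ δ, ∃ y ∈ 𝒩 ε, z = x ⊗ₜ[R] y}

/-- There is an isomorphism of degree `1` of graded `R`-algebras between `A` and `B`. -/
def GradedAlgIsomorphic (R : Type*) {A B : Type*} [CommRing R] [CommRing A] [CommRing B]
    [Algebra R A] [Algebra R B] (𝒜 : GradingGroup → AddSubgroup A)
    (ℬ : GradingGroup → AddSubgroup B) : Prop :=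
  ∃ e : A ≃ₐ[R] B, ∀ γ a, a ∈ 𝒜 γ ↔ e a ∈ ℬ γ

/-- `A` is a graded form of `B` with respect to the extension `ℓ` of `k`: the graded `ℓ`-algebras
`ℓ ⊗ A` and `ℓ ⊗ B` are isomorphic. -/
def IsGradedForm {k L A B : Type*} [CommRing k] [CommRing L] [CommRing A] [CommRing B]
    [Algebra k L] [Algebra k A] [Algebra k B] (ℒ : GradingGroup → AddSubgroup L)
    (𝒜 : GradingGroup → AddSubgroup A) (ℬ : GradingGroup → AddSubgroup B) : Prop :=
  GradedAlgIsomorphic L (tensorGrading (R := k) ℒ 𝒜) (tensorGrading (R := k) ℒ ℬ)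

/-- A graded Hopf algebra over the graded ring `k`: a graded `k`-algebra with a Hopf algebra
structure whose comultiplication, counit and antipode are graded of degree `1`. -/
structure IsGradedHopfAlgebra {k A : Type*} [CommRing k] [CommRing A] [HopfAlgebra k A]
    (𝒦 : GradingGroup → AddSubgroup k) (𝒜 : GradingGroup → AddSubgroup A) : Prop where
  isInternal : DirectSum.IsInternal 𝒜
  gradedMonoid : SetLike.GradedMonoid 𝒜
  algebraMap_mem : ∀ γ, ∀ a ∈ 𝒦 γ, algebraMap k A a ∈ 𝒜 γ
  comul_mem : ∀ γ, ∀ a ∈ 𝒜 γ, CoalgebraStruct.comul (R := k) a ∈ tensorGrading (R := k) 𝒜 𝒜 γ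
  counit_mem : ∀ γ, ∀ a ∈ 𝒜 γ, CoalgebraStruct.counit (R := k) a ∈ 𝒦 γ
  antipode_mem : ∀ γ, ∀ a ∈ 𝒜 γ, HopfAlgebra.antipode k a ∈ 𝒜 γ

/-- `K` is a graded algebraic closure of the graded field `k`: an extension of graded fields, all
homogeneous elements of which are algebraic over `k`, and such that every homogeneous
polynomial of positive monomial degree in `K[r⁻¹T]` has a root in `K_r`, for every degree `r`. -/
structure IsGradedAlgClosure {k K : Type*} [CommRing k] [CommRing K] [Algebra k K]
    (𝒦 : GradingGroup → AddSubgroup k) (𝒦' : GradingGroup → AddSubgroup K) [GradedRing 𝒦'] :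
    Prop where
  isGradedField : IsGradedField 𝒦'
  algebraMap_mem : ∀ γ, ∀ a ∈ 𝒦 γ, algebraMap k K a ∈ 𝒦' γ
  algebraic : ∀ r, ∀ x ∈ 𝒦' r, ∃ s, ∃ f ∈ polyGrading 𝒦 r s, f ≠ 0 ∧ Polynomial.aeval x f = 0
  exists_root : ∀ r s, ∀ f ∈ polyGrading 𝒦' r s, 0 < f.natDegree → ∃ x ∈ 𝒦' r, f.IsRoot x

/-! ### Characteristic `p` -/

/-- The `p ^ i`-power map is additive in a ring in which `p = 0`. -/
lemma add_pow_prime_pow_of_eq_zero {R : Type*} [CommRing R] {p : ℕ} [hp : Fact p.Prime]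
    (h : (p : R) = 0) (x y : R) (i : ℕ) : (x + y) ^ p ^ i = x ^ p ^ i + y ^ p ^ i := by
  rcases subsingleton_or_nontrivial R with h' | h'
  · exact Subsingleton.elim _ _
  · have : CharP R p := (CharP.charP_iff_prime_eq_zero hp.out).2 h
    exact add_pow_char_pow x y p i

/-- If `k_1` has characteristic `p`, then `p = 0` in every `k`-algebra. -/
lemma natCast_eq_zero_of_grade_zero {k : Type*} [CommRing k] (𝒦 : GradingGroup → AddSubgroup k)
    [GradedRing 𝒦] (p : ℕ) [CharP (degreeOne 𝒦) p] (S : Type*) [CommRing S] [Algebra k S] :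
    (p : S) = 0 := by
  have h' : (p : k) = 0 := by
    have h := map_natCast (algebraMap (degreeOne 𝒦) k) p
    rw [CharP.cast_eq_zero, map_zero] at h
    exact h.symm
  rw [← map_natCast (algebraMap k S), h', map_zero]

/-- The extension `ℓ = k^{p⁻ⁿ} = {x ∈ K : x^{pⁿ} ∈ k}` of `k`, where `K` is a graded algebraic
closure of `k`. -/
def rootExtension {k : Type*} [CommRing k] (𝒦 : GradingGroup → AddSubgroup k) [GradedRing 𝒦]
    (p : ℕ) [Fact p.Prime] [CharP (degreeOne 𝒦) p] (n : ℕ) (K : Type*) [CommRing K] [Algebra k K] :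
    Subalgebra k K where
  carrier := {x | x ^ p ^ n ∈ (algebraMap k K).range}
  mul_mem' {x y} hx hy := by
    change (x * y) ^ p ^ n ∈ (algebraMap k K).range
    rw [mul_pow]; exact mul_mem hx hy
  add_mem' {x y} hx hy := by
    change (x + y) ^ p ^ n ∈ (algebraMap k K).range
    rw [add_pow_prime_pow_of_eq_zero (natCast_eq_zero_of_grade_zero 𝒦 p K)]
    exact add_mem hx hy
  algebraMap_mem' a := pow_mem (RingHom.mem_range_self _ a) _

/-- The grading that a subalgebra inherits from the ambient algebra. -/
def subalgebraGrading {k K : Type*} [CommRing k] [CommRing K] [Algebra k K]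
    (𝒦' : GradingGroup → AddSubgroup K) (L : Subalgebra k K) (γ : GradingGroup) :
    AddSubgroup L :=
  (𝒦' γ).comap L.val.toAddMonoidHom

/-! ### Endomorphisms of the additive group -/

/-- The action of `ℕ` on `R` by powers of the Frobenius endomorphism. -/
@[reducible] noncomputable def frobeniusAction (R : Type*) [CommRing R] (p : ℕ) [ExpChar R p] :
    MulSemiringAction (Multiplicative ℕ) R where
  smul i a := iterateFrobenius R p (Multiplicative.toAdd i) a
  one_smul a := iterateFrobenius_zero_apply R p a
  mul_smul i j a := iterateFrobenius_add_apply R p (Multiplicative.toAdd i)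
    (Multiplicative.toAdd j) a
  smul_zero i := map_zero (iterateFrobenius R p (Multiplicative.toAdd i))
  smul_add i := map_add (iterateFrobenius R p (Multiplicative.toAdd i))
  smul_one i := map_one (iterateFrobenius R p (Multiplicative.toAdd i))
  smul_mul i := map_mul (iterateFrobenius R p (Multiplicative.toAdd i))

/-- The noncommutative polynomial ring `R[F]`, with the relations `F a = a ^ p F`.  For a field
`R` of characteristic `p` this is the endomorphism ring of the additive group over `R`. -/
def TwistedPolynomial (R : Type*) [CommRing R] (p : ℕ) [ExpChar R p] : Type _ :=
  SkewPolynomial R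

namespace TwistedPolynomial

variable {R : Type*} [CommRing R] {p : ℕ} [ExpChar R p]

noncomputable instance : Ring (TwistedPolynomial R p) :=
  letI := frobeniusAction R p
  inferInstanceAs (Ring (SkewMonoidAlgebra R (Multiplicative ℕ)))

/-- The coefficient `aᵢ` of `∑ aᵢ Fⁱ`. -/
def coeff (τ : TwistedPolynomial R p) (i : ℕ) : R := SkewPolynomial.coeff τ i

/-- The constant polynomial `a`. -/
noncomputable def C (a : R) : TwistedPolynomial R p := SkewPolynomial.C a

/-- The variable `F`. -/
noncomputable def F : TwistedPolynomial R p := SkewPolynomial.X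

/-- Separable endomorphisms: those with `a₀ ≠ 0`. -/
def IsSeparable (τ : TwistedPolynomial R p) : Prop := τ.coeff 0 ≠ 0

/-- The finite set of the `i` with `aᵢ ≠ 0`. -/
def support (τ : TwistedPolynomial R p) : Finset ℕ := SkewPolynomial.support τ

/-- `τ⁽ⁿ⁾`: the `n`-th Frobenius `a ↦ a ^ pⁿ` applied to the coefficients. -/
noncomputable def frobeniusTwist (n : ℕ) (τ : TwistedPolynomial R p) : TwistedPolynomial R p :=
  ∑ i ∈ τ.support, C (τ.coeff i ^ p ^ n) * F ^ i

/-- The `p`-polynomial `τ(T) = ∑ aᵢ T^{pⁱ}` of `τ = ∑ aᵢ Fⁱ`. -/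
noncomputable def toPolynomial (τ : TwistedPolynomial R p) : Polynomial R :=
  ∑ i ∈ τ.support, Polynomial.monomial (p ^ i) (τ.coeff i)

lemma F_mul_C (a : R) : (F : TwistedPolynomial R p) * C a = C (a ^ p) * F := by
  let := frobeniusAction R p
  have h : (SkewPolynomial.X : SkewPolynomial R) * SkewPolynomial.C a
      = SkewPolynomial.C (a ^ p) * SkewPolynomial.X := by
    rw [SkewPolynomial.C_mul_X_eq_monomial, ← SkewPolynomial.monomial_one_one_eq_X,
      SkewPolynomial.monomial_mul_C]
    congr 1
    change 1 * iterateFrobenius R p 1 a = a ^ p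
    rw [one_mul, iterateFrobenius_def, pow_one]
  exact h

lemma eq_sum (τ : TwistedPolynomial R p) : τ = ∑ i ∈ τ.support, C (τ.coeff i) * F ^ i := by
  let := frobeniusAction R p
  have h : ∀ q : SkewPolynomial R, q = ∑ i ∈ q.support,
      SkewPolynomial.C (q.coeff i) * SkewPolynomial.X ^ i := fun q => by
    simp only [SkewPolynomial.C_mul_X_pow_eq_monomial]
    rw [← SkewPolynomial.sum_def q (fun i a => SkewPolynomial.monomial i a)]
    exact (SkewMonoidAlgebra.sum_single q).symm
  exact h τ

/-- `τ(T)` defines an additive map on every `R`-algebra in which `p = 0`. -/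
lemma aeval_toPolynomial_add [Fact p.Prime] {S : Type*} [CommRing S] [Algebra R S]
    (hS : (p : S) = 0) (τ : TwistedPolynomial R p) (x y : S) :
    Polynomial.aeval (x + y) τ.toPolynomial =
      Polynomial.aeval x τ.toPolynomial + Polynomial.aeval y τ.toPolynomial := by
  simp only [toPolynomial, map_sum, Polynomial.aeval_monomial,
    add_pow_prime_pow_of_eq_zero hS, mul_add, Finset.sum_add_distrib]

end TwistedPolynomial

/-- `f = a₀ T + a₁ T^p + ⋯ + a_m T^{p^m}` is a `p`-polynomial. -/
def IsPPolynomial {R : Type*} [CommRing R] (p : ℕ) (f : Polynomial R) : Prop :=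
  ∃ (m : ℕ) (a : ℕ → R), f = ∑ i ∈ Finset.range (m + 1), Polynomial.monomial (p ^ i) (a i)

/-! ### The algebra `A(τ)` -/

section Russell

variable {k : Type*} [CommRing k] {𝒦 : GradingGroup → AddSubgroup k} [GradedRing 𝒦]
  {p : ℕ} [Fact p.Prime] [CharP (degreeOne 𝒦) p]

/-- The polynomial `τ(T)` of `τ ∈ k_1[F]`, viewed in `k[T]`. -/
noncomputable def associatedPolynomial (τ : TwistedPolynomial (degreeOne 𝒦) p) : Polynomial k :=
  τ.toPolynomial.map (algebraMap (degreeOne 𝒦) k)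

/-- `A(τ) = k[T₁, T₂] / (T₂^{pⁿ} - f(T₁))` for `f(T) = τ(T)`. -/
def RussellAlgebra (n : ℕ) (τ : TwistedPolynomial (degreeOne 𝒦) p) : Type _ :=
  MvPolynomial (Fin 2) k ⧸ (Ideal.span {MvPolynomial.X 1 ^ p ^ n -
    Polynomial.aeval (MvPolynomial.X 0) (associatedPolynomial τ)} : Ideal (MvPolynomial (Fin 2) k))

namespace RussellAlgebra

variable (n : ℕ) (τ : TwistedPolynomial (degreeOne 𝒦) p)

noncomputable instance : CommRing (RussellAlgebra n τ) :=
  inferInstanceAs (CommRing (_ ⧸ _))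

noncomputable instance instAlgebra : Algebra k (RussellAlgebra n τ) :=
  inferInstanceAs (Algebra k (MvPolynomial (Fin 2) k ⧸ _))

/-- The projection `k[T₁, T₂] → A(τ)`. -/
noncomputable def mk : MvPolynomial (Fin 2) k →ₐ[k] RussellAlgebra n τ :=
  Ideal.Quotient.mkₐ k _

/-- The class of `T₁`. -/
noncomputable def x : RussellAlgebra n τ := mk n τ (MvPolynomial.X 0)

/-- The class of `T₂`. -/
noncomputable def y : RussellAlgebra n τ := mk n τ (MvPolynomial.X 1)

/-- The quotient grading, for `T₁` and `T₂` of degree `1`. -/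
noncomputable def grading (γ : GradingGroup) : AddSubgroup (RussellAlgebra n τ) :=
  (planeGrading 𝒦 γ).map (mk n τ : MvPolynomial (Fin 2) k →+ RussellAlgebra n τ)

lemma y_pow : y n τ ^ p ^ n = Polynomial.aeval (x n τ) (associatedPolynomial τ) := by
  rw [x, y, ← map_pow, Polynomial.aeval_algHom_apply, ← sub_eq_zero, ← map_sub]
  exact Ideal.Quotient.eq_zero_iff_mem.2 (Ideal.subset_span rfl)

variable {n τ}

lemma associatedPolynomial_add {S : Type*} [CommRing S] [Algebra k S] (a b : S) :
    Polynomial.aeval (a + b) (associatedPolynomial τ) =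
      Polynomial.aeval a (associatedPolynomial τ) +
        Polynomial.aeval b (associatedPolynomial τ) := by
  let : Algebra (degreeOne 𝒦) S := ((algebraMap k S).comp (algebraMap (degreeOne 𝒦) k)).toAlgebra
  have : IsScalarTower (degreeOne 𝒦) k S := IsScalarTower.of_algebraMap_eq fun _ => rfl
  simp only [associatedPolynomial, Polynomial.aeval_map_algebraMap]
  exact TwistedPolynomial.aeval_toPolynomial_add (natCast_eq_zero_of_grade_zero 𝒦 p S) τ a b

/-- Algebra homomorphisms out of `A(τ)` correspond to solutions of `b^{pⁿ} = f(a)`. -/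
noncomputable def lift {S : Type*} [CommRing S] [Algebra k S] (a b : S)
    (h : b ^ p ^ n = Polynomial.aeval a (associatedPolynomial τ)) :
    RussellAlgebra n τ →ₐ[k] S :=
  Ideal.Quotient.liftₐ _ (MvPolynomial.aeval ![a, b]) fun z hz => by
    have hle : Ideal.span {MvPolynomial.X 1 ^ p ^ n -
        Polynomial.aeval (MvPolynomial.X 0) (associatedPolynomial τ)} ≤
        RingHom.ker (MvPolynomial.aeval (R := k) ![a, b]) := by
      rw [Ideal.span_le, Set.singleton_subset_iff, SetLike.mem_coe, RingHom.mem_ker, map_sub,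
        map_pow, ← Polynomial.aeval_algHom_apply]
      simp [h]
    exact hle hz

@[simp] lemma lift_x {S : Type*} [CommRing S] [Algebra k S] (a b : S)
    (h : b ^ p ^ n = Polynomial.aeval a (associatedPolynomial τ)) : lift a b h (x n τ) = a := by
  change MvPolynomial.aeval ![a, b] (MvPolynomial.X 0) = a
  simp

@[simp] lemma lift_y {S : Type*} [CommRing S] [Algebra k S] (a b : S)
    (h : b ^ p ^ n = Polynomial.aeval a (associatedPolynomial τ)) : lift a b h (y n τ) = b := by
  change MvPolynomial.aeval ![a, b] (MvPolynomial.X 1) = b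
  simp

lemma algHom_ext {S : Type*} [CommRing S] [Algebra k S] {φ ψ : RussellAlgebra n τ →ₐ[k] S}
    (hx : φ (x n τ) = ψ (x n τ)) (hy : φ (y n τ) = ψ (y n τ)) : φ = ψ := by
  have h : φ.comp (mk n τ) = ψ.comp (mk n τ) := by
    apply MvPolynomial.algHom_ext
    intro i
    fin_cases i
    · exact hx
    · exact hy
  ext z
  obtain ⟨w, rfl⟩ := Ideal.Quotient.mk_surjective z
  exact DFunLike.congr_fun h w

lemma relation_map {S : Type*} [CommRing S] [Algebra k S] (φ : RussellAlgebra n τ →ₐ[k] S) :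
    φ (y n τ) ^ p ^ n = Polynomial.aeval (φ (x n τ)) (associatedPolynomial τ) := by
  rw [← map_pow, y_pow, Polynomial.aeval_algHom_apply]

lemma relation_add {S : Type*} [CommRing S] [Algebra k S] {a b a' b' : S}
    (h : b ^ p ^ n = Polynomial.aeval a (associatedPolynomial τ))
    (h' : b' ^ p ^ n = Polynomial.aeval a' (associatedPolynomial τ)) :
    (b + b') ^ p ^ n = Polynomial.aeval (a + a') (associatedPolynomial τ) := by
  rw [add_pow_prime_pow_of_eq_zero (natCast_eq_zero_of_grade_zero 𝒦 p S), h, h',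
    associatedPolynomial_add]

lemma relation_zero {S : Type*} [CommRing S] [Algebra k S] :
    (0 : S) ^ p ^ n = Polynomial.aeval (0 : S) (associatedPolynomial τ) := by
  have h := associatedPolynomial_add (τ := τ) (0 : S) 0
  rw [add_zero, left_eq_add] at h
  rw [h, zero_pow (pow_ne_zero _ (Fact.out : p.Prime).ne_zero)]

lemma relation_neg {S : Type*} [CommRing S] [Algebra k S] {a b : S}
    (h : b ^ p ^ n = Polynomial.aeval a (associatedPolynomial τ)) :
    (-b) ^ p ^ n = Polynomial.aeval (-a) (associatedPolynomial τ) := by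
  have h1 := add_pow_prime_pow_of_eq_zero (natCast_eq_zero_of_grade_zero 𝒦 p S) b (-b) n
  have h2 := associatedPolynomial_add (τ := τ) a (-a)
  rw [add_neg_cancel, relation_zero (τ := τ)] at h1
  rw [add_neg_cancel] at h2
  rw [h1, h] at h2
  exact add_left_cancel h2

variable (n τ)

/-- The comultiplication `T ↦ T ⊗ 1 + 1 ⊗ T` for `T = T₁, T₂`. -/
noncomputable def comulHom : RussellAlgebra n τ →ₐ[k] RussellAlgebra n τ ⊗[k] RussellAlgebra n τ :=
  lift (x n τ ⊗ₜ 1 + 1 ⊗ₜ x n τ) (y n τ ⊗ₜ 1 + 1 ⊗ₜ y n τ)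
    (relation_add
      (relation_map (Algebra.TensorProduct.includeLeft :
        RussellAlgebra n τ →ₐ[k] RussellAlgebra n τ ⊗[k] RussellAlgebra n τ))
      (relation_map (Algebra.TensorProduct.includeRight :
        RussellAlgebra n τ →ₐ[k] RussellAlgebra n τ ⊗[k] RussellAlgebra n τ)))

/-- The counit `T₁, T₂ ↦ 0`. -/
noncomputable def counitHom : RussellAlgebra n τ →ₐ[k] k := lift 0 0 relation_zero

/-- The antipode `T ↦ -T` for `T = T₁, T₂`. -/
noncomputable def antipodeHom : RussellAlgebra n τ →ₐ[k] RussellAlgebra n τ :=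
  lift (-x n τ) (-y n τ) (relation_neg (y_pow n τ))

/-- The Hopf algebra structure of `A(τ)` coming from the two-dimensional additive group. -/
noncomputable instance instBialgebra : Bialgebra k (RussellAlgebra n τ) :=
  Bialgebra.ofAlgHom (comulHom n τ) (counitHom n τ)
    (by apply algHom_ext <;>
      simp [comulHom, TensorProduct.add_tmul, TensorProduct.tmul_add, add_assoc,
        Algebra.TensorProduct.one_def])
    (by apply algHom_ext <;> simp [comulHom, counitHom])
    (by apply algHom_ext <;> simp [comulHom, counitHom])

noncomputable instance instHopfAlgebra : HopfAlgebra k (RussellAlgebra n τ) :=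
  HopfAlgebra.ofAlgHom (antipodeHom n τ)
    (by
      change (Algebra.TensorProduct.lift (antipodeHom n τ) (.id k _) fun _ => Commute.all _).comp
        (comulHom n τ) = (Algebra.ofId k _).comp (counitHom n τ)
      apply algHom_ext <;> simp [comulHom, counitHom, antipodeHom])
    (by
      change (Algebra.TensorProduct.lift (.id k _) (antipodeHom n τ) fun _ _ => Commute.all _ _).comp
        (comulHom n τ) = (Algebra.ofId k _).comp (counitHom n τ)
      apply algHom_ext <;> simp [comulHom, counitHom, antipodeHom])

end RussellAlgebra

end Russell

/-! A homomorphism out of `A(τ)` is a point of the curve `y ^ pⁿ = ∑ aᵢ x ^ pⁱ`. As soon as `aᵢ = bᵢ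
^ pⁿ`, the line maps to it by `z ↦ (z ^ pⁿ, ∑ bᵢ z ^ pⁱ)`, and because `b₀` is a unit, `z` is in
turn a polynomial in `x` and `y` (`exists_inverse_parametrization`). All coefficients involved have
degree `1`, so such isomorphisms respect the gradings. Over `ℓ` the roots `bᵢ` exist, which makes
`A(τ)` a form of `k[T]`. Over `k`, rescaling `x` by `c` replaces `aᵢ` by `aᵢ c ^ pⁱ`, the
coefficients of `τ c`; this gives the "if" half of the triviality criterion.

Conversely, a graded isomorphism with `k[T]` is already defined over the field `k_1`. Over an
algebraic closure it and the parametrization above describe the same curve, so they differ by an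
affine substitution `w = e T + f`. Comparing coefficients gives `c = e ^ pⁿ` and `dᵢ = bᵢ e ^ pⁱ` in
`k_1` with `aᵢ c ^ pⁱ = dᵢ ^ pⁿ` (`exists_mul_pow_eq_pow_of_parametrization`). Applied to `τ = 1 + a
F`, this forces `a` to be a `p`-th power, whence the statement on perfectness.

That the quotient grading of `A(τ)` is a direct sum is seen from the coaction `a ↦ a ⊗ γ` of the
grading group. -/

/-! ### Coefficients of twisted polynomials and of `p`-polynomials. -/

namespace TwistedPolynomial

variable {R : Type*} [CommRing R] {p : ℕ} [ExpChar R p]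

@[ext] lemma ext {σ τ : TwistedPolynomial R p} (h : ∀ i, σ.coeff i = τ.coeff i) : σ = τ :=
  SkewPolynomial.ext h

lemma mem_support_iff {τ : TwistedPolynomial R p} {i : ℕ} : i ∈ τ.support ↔ τ.coeff i ≠ 0 :=
  SkewPolynomial.mem_support_iff

/-- The coefficient `aᵢ`, as an additive map. -/
noncomputable def coeffHom (i : ℕ) : TwistedPolynomial R p →+ R where
  toFun τ := τ.coeff i
  map_zero' := rfl
  map_add' σ τ := SkewPolynomial.coeff_add σ τ _

lemma coeff_C_mul_F_pow (a : R) (i j : ℕ) :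
    (C a * F ^ i : TwistedPolynomial R p).coeff j = if i = j then a else 0 := by
  let := frobeniusAction R p
  have h : SkewPolynomial.coeff (SkewPolynomial.C a * SkewPolynomial.X ^ i : SkewPolynomial R) j
      = if i = j then a else 0 := by
    rw [SkewPolynomial.C_mul_X_pow_eq_monomial, SkewPolynomial.coeff_monomial]
  exact h

lemma coeff_sum_C_mul_F_pow (s : Finset ℕ) (a : ℕ → R) (j : ℕ) :
    (∑ i ∈ s, C (a i) * F ^ i : TwistedPolynomial R p).coeff j = if j ∈ s then a j else 0 := by
  change coeffHom j _ = _
  rw [map_sum]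
  change ∑ i ∈ s, (C (a i) * F ^ i : TwistedPolynomial R p).coeff j = _
  simp [coeff_C_mul_F_pow]

lemma C_mul_C (a b : R) : (C a * C b : TwistedPolynomial R p) = C (a * b) := by
  let := frobeniusAction R p
  have h : (SkewPolynomial.C (a * b) : SkewPolynomial R) = SkewPolynomial.C a * SkewPolynomial.C b :=
    SkewPolynomial.C_mul
  exact h.symm

lemma F_pow_mul_C (i : ℕ) (a : R) :
    (F ^ i * C a : TwistedPolynomial R p) = C (a ^ p ^ i) * F ^ i := by
  induction i generalizing a with
  | zero => simp
  | succ i ih => rw [pow_succ, mul_assoc, F_mul_C, ← mul_assoc, ih, mul_assoc, ← pow_mul,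
      ← pow_succ']

/-- Moving `c` to the left past `F ^ i` raises it to the power `pⁱ`. This turns the condition on `τ
c` into conditions on single coefficients. -/
lemma coeff_mul_C (τ : TwistedPolynomial R p) (c : R) (i : ℕ) :
    (τ * C c).coeff i = τ.coeff i * c ^ p ^ i := by
  have h : τ * C c = ∑ j ∈ τ.support, C (τ.coeff j * c ^ p ^ j) * F ^ j := by
    conv_lhs => rw [eq_sum τ]
    rw [Finset.sum_mul]
    refine Finset.sum_congr rfl fun j _ => ?_
    rw [mul_assoc, F_pow_mul_C, ← mul_assoc, C_mul_C]
  rw [h, coeff_sum_C_mul_F_pow]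
  split_ifs with hi
  · rfl
  · rw [mem_support_iff, not_not] at hi
    rw [hi, zero_mul]

lemma coeff_frobeniusTwist [Fact p.Prime] (n : ℕ) (τ : TwistedPolynomial R p) (i : ℕ) :
    (τ.frobeniusTwist n).coeff i = τ.coeff i ^ p ^ n := by
  rw [frobeniusTwist, coeff_sum_C_mul_F_pow (a := fun i => τ.coeff i ^ p ^ n)]
  split_ifs with hi
  · rfl
  · rw [mem_support_iff, not_not] at hi
    rw [hi, zero_pow (pow_ne_zero _ (Fact.out : p.Prime).ne_zero)]

/-- Supplies one index range for all the sums below. It always contains `0`, so the linear term can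
be split off. -/
lemma exists_coeff_eq_zero (τ : TwistedPolynomial R p) :
    ∃ m, ∀ i, i ∉ Finset.range (m + 1) → τ.coeff i = 0 := by
  refine ⟨τ.support.sup id, fun i hi => ?_⟩
  by_contra h
  have h1 := Finset.le_sup (f := id) (mem_support_iff.2 h)
  simp only [id, Finset.mem_range] at h1 hi
  omega

lemma toPolynomial_eq_sum (τ : TwistedPolynomial R p) {m : ℕ}
    (hm : ∀ i, i ∉ Finset.range (m + 1) → τ.coeff i = 0) :
    τ.toPolynomial = ∑ i ∈ Finset.range (m + 1), Polynomial.monomial (p ^ i) (τ.coeff i) := by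
  refine Finset.sum_subset (fun i hi => ?_) fun i _ hi => ?_
  · by_contra h
    exact mem_support_iff.1 hi (hm i h)
  · rw [mem_support_iff, not_not] at hi
    rw [hi, map_zero]

lemma aeval_toPolynomial (τ : TwistedPolynomial R p) {m : ℕ}
    (hm : ∀ i, i ∉ Finset.range (m + 1) → τ.coeff i = 0) {S : Type*} [CommRing S] [Algebra R S]
    (x : S) : Polynomial.aeval x τ.toPolynomial =
      ∑ i ∈ Finset.range (m + 1), τ.coeff i • x ^ p ^ i := by
  simp [toPolynomial_eq_sum τ hm, Polynomial.aeval_monomial, Algebra.smul_def]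

end TwistedPolynomial

/-- The coefficients of an additive polynomial. -/
lemma Polynomial.coeff_sum_monomial_pow {R : Type*} [CommRing R] {p : ℕ} [hp : Fact p.Prime]
    (s : Finset ℕ) (a : ℕ → R) (j : ℕ) :
    (∑ i ∈ s, Polynomial.monomial (p ^ i) (a i)).coeff (p ^ j) = if j ∈ s then a j else 0 := by
  simp [Polynomial.coeff_monomial,
    (Nat.pow_right_injective hp.out.two_le).eq_iff]

lemma TwistedPolynomial.coeff_toPolynomial {R : Type*} [CommRing R] {p : ℕ} [ExpChar R p]
    [Fact p.Prime] (τ : TwistedPolynomial R p) (j : ℕ) :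
    τ.toPolynomial.coeff (p ^ j) = τ.coeff j := by
  rw [toPolynomial, Polynomial.coeff_sum_monomial_pow]
  split_ifs with hi
  · rfl
  · rw [mem_support_iff, not_not] at hi
    exact hi.symm

/-! ### Inverting the parametrization of the curve. -/

lemma sum_pow_prime_pow_of_eq_zero {R ι : Type*} [CommRing R] {p : ℕ} [hp : Fact p.Prime]
    (h : (p : R) = 0) (s : Finset ι) (f : ι → R) (i : ℕ) :
    (∑ j ∈ s, f j) ^ p ^ i = ∑ j ∈ s, f j ^ p ^ i :=
  map_sum (⟨⟨fun x => x ^ p ^ i, zero_pow (pow_ne_zero _ hp.out.ne_zero)⟩,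
    fun x y => add_pow_prime_pow_of_eq_zero h x y i⟩ : R →+ R) f s

lemma sub_pow_prime_pow_of_eq_zero {R : Type*} [CommRing R] {p : ℕ} [hp : Fact p.Prime]
    (h : (p : R) = 0) (x y : R) (i : ℕ) : (x - y) ^ p ^ i = x ^ p ^ i - y ^ p ^ i := by
  rw [eq_sub_iff_add_eq, ← add_pow_prime_pow_of_eq_zero h, sub_add_cancel]

/-- If the coefficients of a separable additive polynomial are the `pⁿ`-th powers of the `bᵢ`, then
`z ↦ (z ^ pⁿ, ∑ bᵢ z ^ pⁱ)` is an isomorphism of the affine line with the curve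
`y ^ pⁿ = ∑ bᵢ ^ pⁿ x ^ pⁱ`. -/
theorem exists_inverse_parametrization.{u, v} {R : Type u} [CommRing R] {p : ℕ} [hp : Fact p.Prime]
    (hR : (p : R) = 0) (m : ℕ) (b : ℕ → R) (h0 : IsUnit (b 0)) (n : ℕ) :
    ∃ θ : MvPolynomial (Fin 2) R, ∀ (S : Type v) [CommRing S] [Algebra R S],
      (∀ z : S, MvPolynomial.aeval
        ![z ^ p ^ n, ∑ i ∈ Finset.range (m + 1), b i • z ^ p ^ i] θ = z) ∧
      ∀ x y : S, y ^ p ^ n = ∑ i ∈ Finset.range (m + 1), b i ^ p ^ n • x ^ p ^ i →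
        MvPolynomial.aeval ![x, y] θ ^ p ^ n = x ∧
          ∑ i ∈ Finset.range (m + 1), b i • MvPolynomial.aeval ![x, y] θ ^ p ^ i = y := by
  obtain ⟨u, hu⟩ := h0
  induction n with
  | zero =>
    refine ⟨MvPolynomial.X 0, fun S _ _ => ⟨fun z => by simp, fun x y h => ?_⟩⟩
    simpa using h.symm
  | succ n ih =>
    obtain ⟨θ, hθ⟩ := ih
    -- The `p`-th root of `x` on the curve of level `n + 1`: extract formal `p`-th roots in its
    -- equation and solve for the linear term, using that `b 0` is a unit. Then `(w, y)` lies on the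
    -- curve of level `n`, so `θ(w, y)` is the new inverse.
    let w : MvPolynomial (Fin 2) R := ((↑u⁻¹ : R) ^ p ^ n) • (MvPolynomial.X 1 ^ p ^ n -
      ∑ i ∈ Finset.range m, b (i + 1) ^ p ^ n • MvPolynomial.X 0 ^ p ^ i)
    have hw : ∀ (S : Type v) [CommRing S] [Algebra R S] (x y : S), MvPolynomial.aeval ![x, y] w =
        ((↑u⁻¹ : R) ^ p ^ n) • (y ^ p ^ n -
          ∑ i ∈ Finset.range m, b (i + 1) ^ p ^ n • x ^ p ^ i) := by
      intro S _ _ x y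
      simp [w]
    have hu' : (↑u⁻¹ : R) ^ p ^ n * b 0 ^ p ^ n = 1 := by
      rw [← mul_pow, ← hu, Units.inv_mul, one_pow]
    have hu'' : (↑u⁻¹ : R) ^ p ^ (n + 1) * b 0 ^ p ^ (n + 1) = 1 := by
      rw [← mul_pow, ← hu, Units.inv_mul, one_pow]
    have hcomp : ∀ (S : Type v) [CommRing S] [Algebra R S] (x y : S),
        MvPolynomial.aeval ![x, y] (MvPolynomial.aeval ![w, MvPolynomial.X 1] θ) =
          MvPolynomial.aeval ![MvPolynomial.aeval ![x, y] w, y] θ := by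
      intro S _ _ x y
      rw [← AlgHom.comp_apply, MvPolynomial.comp_aeval]
      congr 2
      funext i
      fin_cases i <;> simp
    refine ⟨MvPolynomial.aeval ![w, MvPolynomial.X 1] θ, fun S _ _ => ?_⟩
    have hS : (p : S) = 0 := by rw [← map_natCast (algebraMap R S), hR, map_zero]
    refine ⟨fun z => ?_, fun x y h => ?_⟩
    · rw [hcomp]
      -- It remains to see that `w` takes the value `z ^ pⁿ` at the point with parameter `z`: all
      -- terms but the linear one cancel.
      convert (hθ S).1 z using 4
      rw [hw, sum_pow_prime_pow_of_eq_zero hS, Finset.sum_range_succ', add_comm,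
        add_sub_assoc, ← Finset.sum_sub_distrib, Finset.sum_eq_zero, add_zero, pow_zero, pow_one,
        smul_pow, smul_smul, hu', one_smul]
      intro i _
      rw [smul_pow, ← pow_mul, ← pow_mul, ← pow_add, ← pow_add, show n + 1 + i = i + 1 + n by omega,
        sub_self]
    · rw [hcomp]
      have hwx : MvPolynomial.aeval ![x, y] w ^ p = x := by
        have h1 : (y ^ p ^ n - ∑ i ∈ Finset.range m, b (i + 1) ^ p ^ n • x ^ p ^ i) ^ p =
            b 0 ^ p ^ (n + 1) • x := by
          have h2 := sub_pow_prime_pow_of_eq_zero hS (y ^ p ^ n)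
            (∑ i ∈ Finset.range m, b (i + 1) ^ p ^ n • x ^ p ^ i) 1
          rw [sum_pow_prime_pow_of_eq_zero hS, ← pow_mul, ← pow_add, h, Finset.sum_range_succ',
            pow_zero, pow_one, pow_one] at h2
          refine h2.trans ?_
          rw [sub_eq_iff_eq_add, add_comm, add_right_inj]
          refine Finset.sum_congr rfl fun i _ => ?_
          rw [smul_pow, ← pow_mul, ← pow_mul, ← pow_succ, ← pow_succ]
        rw [hw, smul_pow, h1, smul_smul, ← pow_mul, ← pow_succ, hu'', one_smul]
      have hwy : y ^ p ^ n = ∑ i ∈ Finset.range (m + 1),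
          b i ^ p ^ n • MvPolynomial.aeval ![x, y] w ^ p ^ i := by
        rw [Finset.sum_range_succ', pow_zero, pow_one]
        have h2 : ∀ i, MvPolynomial.aeval ![x, y] w ^ p ^ (i + 1) = x ^ p ^ i := by
          intro i
          rw [pow_succ', pow_mul, hwx]
        simp only [h2]
        rw [hw, smul_smul, mul_comm, hu', one_smul, add_sub_cancel]
      obtain ⟨h3, h4⟩ := (hθ S).2 _ y hwy
      refine ⟨?_, h4⟩
      rw [pow_succ, pow_mul, h3, hwx]

lemma MvPolynomial.aeval_pair_mem {R S : Type*} [CommRing R] [CommRing S] [Algebra R S]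
    {B : Subring S} (hR : ∀ r, algebraMap R S r ∈ B) {x y : S} (hx : x ∈ B) (hy : y ∈ B)
    (θ : MvPolynomial (Fin 2) R) : aeval ![x, y] θ ∈ B := by
  induction θ using MvPolynomial.induction_on with
  | C a => rw [aeval_C]; exact hR a
  | add f g hf hg => rw [map_add]; exact add_mem hf hg
  | mul_X f i hf =>
    rw [map_mul, aeval_X]
    refine mul_mem hf ?_
    fin_cases i
    · exact hx
    · exact hy

/-! ### Graded pieces and maps that respect them. -/

section Gradings

variable {k : Type*} [CommRing k] (𝒦 : GradingGroup → AddSubgroup k)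

instance polyGrading.gradedMonoid [SetLike.GradedMonoid 𝒦] (r : GradingGroup) :
    SetLike.GradedMonoid (polyGrading 𝒦 r) where
  one_mem i := by
    rw [Polynomial.coeff_one]
    split_ifs with h
    · rw [h, zero_nsmul, sub_zero]
      exact SetLike.GradedOne.one_mem
    · exact zero_mem _
  mul_mem γ δ f g hf hg i := by
    rw [Polynomial.coeff_mul]
    refine sum_mem fun x hx => ?_
    have h := SetLike.GradedMul.mul_mem (hf x.1) (hg x.2)
    rwa [sub_add_sub_comm, ← add_nsmul, Finset.HasAntidiagonal.mem_antidiagonal.1 hx] at h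

instance planeGrading.gradedMonoid [SetLike.GradedMonoid 𝒦] :
    SetLike.GradedMonoid (planeGrading 𝒦) where
  one_mem d := by
    classical
    rw [MvPolynomial.coeff_one]
    split_ifs with h
    · exact SetLike.GradedOne.one_mem
    · exact zero_mem _
  mul_mem γ δ f g hf hg d := by
    classical
    rw [MvPolynomial.coeff_mul]
    exact sum_mem fun x _ => SetLike.GradedMul.mul_mem (hf x.1) (hg x.2)

instance tensorGrading.gradedMonoid {A B : Type*} [CommRing A] [CommRing B] [Algebra k A]
    [Algebra k B] (𝒜 : GradingGroup → AddSubgroup A) (ℬ : GradingGroup → AddSubgroup B)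
    [SetLike.GradedMonoid 𝒜] [SetLike.GradedMonoid ℬ] :
    SetLike.GradedMonoid (tensorGrading (R := k) 𝒜 ℬ) where
  one_mem := AddSubgroup.subset_closure
    ⟨0, 0, add_zero 0, 1, SetLike.GradedOne.one_mem, 1, SetLike.GradedOne.one_mem, rfl⟩
  mul_mem γ δ a b ha hb := by
    induction ha using AddSubgroup.closure_induction with
    | zero => rw [zero_mul]; exact zero_mem _
    | add _ _ _ _ h1 h2 => rw [add_mul]; exact add_mem h1 h2
    | neg _ _ h => rw [neg_mul]; exact neg_mem h
    | mem a ha =>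
      induction hb using AddSubgroup.closure_induction with
      | zero => rw [mul_zero]; exact zero_mem _
      | add _ _ _ _ h1 h2 => rw [mul_add]; exact add_mem h1 h2
      | neg _ _ h => rw [mul_neg]; exact neg_mem h
      | mem b hb =>
        obtain ⟨i, j, rfl, x, hx, y, hy, rfl⟩ := ha
        obtain ⟨i', j', rfl, x', hx', y', hy', rfl⟩ := hb
        exact AddSubgroup.subset_closure ⟨i + i', j + j', add_add_add_comm .., x * x',
          SetLike.GradedMul.mul_mem hx hx', y * y', SetLike.GradedMul.mul_mem hy hy',
          Algebra.TensorProduct.tmul_mul_tmul ..⟩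

instance subalgebraGrading.gradedMonoid {K : Type*} [CommRing K] [Algebra k K]
    (𝒦' : GradingGroup → AddSubgroup K) [SetLike.GradedMonoid 𝒦'] (L : Subalgebra k K) :
    SetLike.GradedMonoid (subalgebraGrading 𝒦' L) where
  one_mem := (SetLike.GradedOne.one_mem : (1 : K) ∈ 𝒦' 0)
  mul_mem _ _ x y hx hy := (SetLike.GradedMul.mul_mem hx hy : (x : K) * y ∈ 𝒦' _)

variable {𝒦}

lemma X_mem_polyGrading [SetLike.GradedMonoid 𝒦] :
    (Polynomial.X : Polynomial k) ∈ polyGrading 𝒦 0 0 := by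
  intro i
  rw [nsmul_zero, sub_zero, Polynomial.coeff_X]
  split_ifs
  · exact SetLike.GradedOne.one_mem
  · exact zero_mem _

lemma algebraMap_mem_polyGrading {γ : GradingGroup} {a : k} (ha : a ∈ 𝒦 γ) :
    algebraMap k (Polynomial k) a ∈ polyGrading 𝒦 0 γ := by
  intro i
  rw [nsmul_zero, sub_zero, Polynomial.algebraMap_eq, Polynomial.coeff_C]
  split_ifs
  · exact ha
  · exact zero_mem _

lemma tmul_mem_tensorGrading {A B : Type*} [CommRing A] [CommRing B] [Algebra k A]
    [Algebra k B] {𝒜 : GradingGroup → AddSubgroup A} {ℬ : GradingGroup → AddSubgroup B}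
    {γ δ : GradingGroup} {a : A} {b : B} (ha : a ∈ 𝒜 γ) (hb : b ∈ ℬ δ) :
    a ⊗ₜ[k] b ∈ tensorGrading (R := k) 𝒜 ℬ (γ + δ) :=
  AddSubgroup.subset_closure ⟨γ, δ, rfl, a, ha, b, hb, rfl⟩

lemma monomial_mem_planeGrading {γ : GradingGroup} {a : k} (ha : a ∈ 𝒦 γ) (d : Fin 2 →₀ ℕ) :
    MvPolynomial.monomial d a ∈ planeGrading 𝒦 γ := by
  classical
  intro e
  rw [MvPolynomial.coeff_monomial]
  split_ifs
  · exact ha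
  · exact zero_mem _

lemma planeGrading_induction {γ : GradingGroup} {motive : MvPolynomial (Fin 2) k → Prop}
    (monomial : ∀ d, ∀ a ∈ 𝒦 γ, motive (MvPolynomial.monomial d a)) (zero : motive 0)
    (add : ∀ f g, motive f → motive g → motive (f + g)) {f : MvPolynomial (Fin 2) k}
    (hf : f ∈ planeGrading 𝒦 γ) : motive f := by
  rw [MvPolynomial.as_sum f]
  exact Finset.sum_induction _ _ add zero fun d _ => monomial d _ (hf d)

section

variable {S : Type*} [CommRing S] (𝒮 : GradingGroup → AddSubgroup S) [SetLike.GradedMonoid 𝒮]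

lemma pow_mem_gradeZero {s : S} (hs : s ∈ 𝒮 0) (n : ℕ) : s ^ n ∈ 𝒮 0 :=
  pow_mem (show s ∈ SetLike.GradeZero.subring 𝒮 from hs) n

lemma smul_pow_sum_mem_gradeZero {R : Type*} [CommRing R] [Algebra R S]
    (hR : ∀ r, algebraMap R S r ∈ 𝒮 0) {s : S} (hs : s ∈ 𝒮 0) (t : Finset ℕ) (b : ℕ → R)
    (e : ℕ → ℕ) : ∑ i ∈ t, b i • s ^ e i ∈ 𝒮 0 := by
  refine sum_mem fun i _ => ?_
  rw [Algebra.smul_def]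
  exact (SetLike.GradeZero.subring 𝒮).mul_mem (hR (b i)) (pow_mem_gradeZero 𝒮 hs _)

lemma aeval_mem_gradeZero {R : Type*} [CommRing R] [Algebra R S]
    (hR : ∀ r, algebraMap R S r ∈ 𝒮 0) {x y : S} (hx : x ∈ 𝒮 0) (hy : y ∈ 𝒮 0)
    (θ : MvPolynomial (Fin 2) R) : MvPolynomial.aeval ![x, y] θ ∈ 𝒮 0 :=
  MvPolynomial.aeval_pair_mem (B := SetLike.GradeZero.subring 𝒮) hR hx hy θ

/-- Both variables have degree `1`, so only the coefficient of a monomial contributes to its degree;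
it suffices to check the images of the generators. -/
lemma map_mem_of_mem_planeGrading [Algebra k S]
    (hS : ∀ γ, ∀ a ∈ 𝒦 γ, algebraMap k S a ∈ 𝒮 γ) (φ : MvPolynomial (Fin 2) k →ₐ[k] S)
    (h0 : φ (MvPolynomial.X 0) ∈ 𝒮 0) (h1 : φ (MvPolynomial.X 1) ∈ 𝒮 0) {γ : GradingGroup}
    {f : MvPolynomial (Fin 2) k} (hf : f ∈ planeGrading 𝒦 γ) : φ f ∈ 𝒮 γ := by
  refine planeGrading_induction (motive := fun f => φ f ∈ 𝒮 γ) (fun d a ha => ?_) ?_ (fun f g hf hg => ?_) hf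
  · rw [MvPolynomial.monomial_eq, map_mul, ← MvPolynomial.algebraMap_eq, AlgHom.commutes,
      ← add_zero γ]
    refine SetLike.GradedMul.mul_mem (hS γ a ha) ?_
    rw [Finsupp.prod_fintype _ _ fun _ => pow_zero _, Fin.prod_univ_two, map_mul, map_pow, map_pow]
    exact (SetLike.GradeZero.subring 𝒮).mul_mem (pow_mem_gradeZero 𝒮 h0 _)
      (pow_mem_gradeZero 𝒮 h1 _)
  · rw [map_zero]; exact zero_mem _
  · rw [map_add]; exact add_mem hf hg

lemma map_mem_of_mem_polyGrading [Algebra k S]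
    (hS : ∀ γ, ∀ a ∈ 𝒦 γ, algebraMap k S a ∈ 𝒮 γ) (φ : Polynomial k →ₐ[k] S)
    (h0 : φ Polynomial.X ∈ 𝒮 0) {γ : GradingGroup}
    {f : Polynomial k} (hf : f ∈ polyGrading 𝒦 0 γ) : φ f ∈ 𝒮 γ := by
  rw [f.as_sum_support_C_mul_X_pow, map_sum]
  refine sum_mem fun i _ => ?_
  have h := hf i
  rw [nsmul_zero, sub_zero] at h
  rw [map_mul, Polynomial.C_eq_algebraMap, AlgHom.commutes, map_pow, ← add_zero γ]
  exact SetLike.GradedMul.mul_mem (hS γ _ h) (pow_mem_gradeZero 𝒮 h0 i)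

end

/-- The coaction `a ↦ a ⊗ γ` (for `a` homogeneous of degree `γ`) that corresponds to a grading. -/
noncomputable def gradingCoaction (𝒦 : GradingGroup → AddSubgroup k) [GradedRing 𝒦] :
    k →+* AddMonoidAlgebra k GradingGroup :=
  (DirectSum.toSemiring (fun γ => (AddMonoidAlgebra.singleAddHom γ).comp (𝒦 γ).subtype)
    rfl fun {i j} a b => (AddMonoidAlgebra.single_mul_single i j (a : k) (b : k)).symm).comp
    (DirectSum.decomposeRingEquiv 𝒦 : k →+* _)

lemma gradingCoaction_of_mem [GradedRing 𝒦] {γ : GradingGroup} {a : k} (ha : a ∈ 𝒦 γ) :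
    gradingCoaction 𝒦 a = AddMonoidAlgebra.single γ a := by
  have h : DirectSum.decomposeRingEquiv 𝒦 a = DirectSum.of (fun γ => 𝒦 γ) γ ⟨a, ha⟩ :=
    DirectSum.decompose_of_mem 𝒦 ha
  rw [gradingCoaction, RingHom.comp_apply, RingHom.coe_coe, h]
  exact DirectSum.toAddMonoid_of ..

end Gradings

/-! ### The grading and the graded Hopf algebra structure of `A(τ)`. -/

namespace RussellAlgebra

variable {k : Type*} [CommRing k] {𝒦 : GradingGroup → AddSubgroup k} [GradedRing 𝒦]
  {p : ℕ} [Fact p.Prime] [CharP (degreeOne 𝒦) p]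
  (n : ℕ) (τ : TwistedPolynomial (degreeOne 𝒦) p)

lemma mk_surjective : Function.Surjective (mk n τ) := Ideal.Quotient.mk_surjective

lemma mk_mem_grading {γ : GradingGroup} {f : MvPolynomial (Fin 2) k} (hf : f ∈ planeGrading 𝒦 γ) :
    mk n τ f ∈ grading n τ γ :=
  AddSubgroup.mem_map_of_mem _ hf

instance grading_gradedMonoid : SetLike.GradedMonoid (grading n τ) where
  one_mem := ⟨1, SetLike.GradedOne.one_mem, map_one (mk n τ)⟩
  mul_mem := by
    rintro γ δ _ _ ⟨a, ha, rfl⟩ ⟨b, hb, rfl⟩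
    exact ⟨a * b, SetLike.GradedMul.mul_mem ha hb, map_mul (mk n τ) a b⟩

lemma algebraMap_mem_grading {γ : GradingGroup} {a : k} (ha : a ∈ 𝒦 γ) :
    algebraMap k (RussellAlgebra n τ) a ∈ grading n τ γ := by
  rw [← AlgHom.commutes (mk n τ)]
  exact mk_mem_grading n τ (monomial_mem_planeGrading ha 0)

lemma x_mem_grading : x n τ ∈ grading n τ 0 :=
  mk_mem_grading n τ (monomial_mem_planeGrading SetLike.GradedOne.one_mem _)

lemma y_mem_grading : y n τ ∈ grading n τ 0 :=
  mk_mem_grading n τ (monomial_mem_planeGrading SetLike.GradedOne.one_mem _)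

variable {n τ}

lemma map_mem_of_mem_grading {S : Type*} [CommRing S] [Algebra k S]
    (𝒮 : GradingGroup → AddSubgroup S) [SetLike.GradedMonoid 𝒮]
    (hS : ∀ γ, ∀ a ∈ 𝒦 γ, algebraMap k S a ∈ 𝒮 γ) (φ : RussellAlgebra n τ →ₐ[k] S)
    (hx : φ (x n τ) ∈ 𝒮 0) (hy : φ (y n τ) ∈ 𝒮 0) {γ : GradingGroup}
    {a : RussellAlgebra n τ} (ha : a ∈ grading n τ γ) : φ a ∈ 𝒮 γ := by
  obtain ⟨f, hf, rfl⟩ := ha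
  exact map_mem_of_mem_planeGrading 𝒮 hS (φ.comp (mk n τ)) hx hy hf

variable (n τ)

/-- The coaction of the grading group on `k[T₁, T₂]`, with values in `A(τ)`. -/
noncomputable def planeCoaction :
    MvPolynomial (Fin 2) k →+* AddMonoidAlgebra (RussellAlgebra n τ) GradingGroup :=
  MvPolynomial.eval₂Hom
    ((AddMonoidAlgebra.mapRingHom GradingGroup (algebraMap k (RussellAlgebra n τ))).comp
      (gradingCoaction 𝒦))
    ![AddMonoidAlgebra.single 0 (x n τ), AddMonoidAlgebra.single 0 (y n τ)]

lemma planeCoaction_C_of_mem {γ : GradingGroup} {a : k} (ha : a ∈ 𝒦 γ) :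
    planeCoaction n τ (MvPolynomial.C a) =
      AddMonoidAlgebra.single γ (algebraMap k (RussellAlgebra n τ) a) := by
  rw [planeCoaction, MvPolynomial.coe_eval₂Hom, MvPolynomial.eval₂_C, RingHom.comp_apply,
    gradingCoaction_of_mem ha]
  simp

lemma planeCoaction_X_zero : planeCoaction n τ (MvPolynomial.X 0) =
    AddMonoidAlgebra.singleZeroRingHom (x n τ) := by
  simp [planeCoaction]

lemma planeCoaction_X_one : planeCoaction n τ (MvPolynomial.X 1) =
    AddMonoidAlgebra.singleZeroRingHom (y n τ) := by
  simp [planeCoaction]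

/-- The coefficients lie in `k_1`, so the coaction places `f(T₁)` purely in degree `1`. Hence the
relation defining `A(τ)` is killed and the coaction descends. -/
lemma planeCoaction_aeval (f : Polynomial (degreeOne 𝒦)) :
    planeCoaction n τ (Polynomial.aeval (MvPolynomial.X 0) (f.map (algebraMap (degreeOne 𝒦) k))) =
      AddMonoidAlgebra.singleZeroRingHom
        (Polynomial.aeval (x n τ) (f.map (algebraMap (degreeOne 𝒦) k))) := by
  induction f using Polynomial.induction_on' with
  | add f g hf hg => simp only [Polynomial.map_add, map_add, hf, hg]
  | monomial i a =>
    have h : planeCoaction n τ (MvPolynomial.C (algebraMap (degreeOne 𝒦) k a)) = _ :=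
      planeCoaction_C_of_mem n τ (γ := 0) a.2
    rw [Polynomial.map_monomial, Polynomial.aeval_monomial, Polynomial.aeval_monomial, map_mul,
      map_pow, planeCoaction_X_zero, MvPolynomial.algebraMap_eq, h, map_mul, map_pow]
    rfl

/-- The coaction of the grading group on `A(τ)`. -/
noncomputable def coaction :
    RussellAlgebra n τ →+* AddMonoidAlgebra (RussellAlgebra n τ) GradingGroup :=
  Ideal.Quotient.lift _ (planeCoaction n τ) fun z hz => by
    have hle : Ideal.span {MvPolynomial.X 1 ^ p ^ n -
        Polynomial.aeval (MvPolynomial.X 0) (associatedPolynomial τ)} ≤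
        RingHom.ker (planeCoaction n τ) := by
      rw [Ideal.span_le, Set.singleton_subset_iff, SetLike.mem_coe, RingHom.mem_ker, map_sub,
        map_pow, associatedPolynomial, planeCoaction_aeval, planeCoaction_X_one, ← map_pow, y_pow,
        associatedPolynomial, sub_self]
    exact hle hz

lemma coaction_of_mem {γ : GradingGroup} {a : RussellAlgebra n τ} (ha : a ∈ grading n τ γ) :
    coaction n τ a = AddMonoidAlgebra.single γ a := by
  obtain ⟨f, hf, rfl⟩ := ha
  change planeCoaction n τ f = AddMonoidAlgebra.single γ (mk n τ f)
  refine planeGrading_induction (motive := fun f =>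
    planeCoaction n τ f = AddMonoidAlgebra.single γ (mk n τ f)) (fun d a ha => ?_) ?_ (fun f g hf hg => ?_) hf
  · rw [MvPolynomial.monomial_eq, Finsupp.prod_fintype _ _ fun _ => pow_zero _,
      Fin.prod_univ_two]
    simp only [map_mul, map_pow, planeCoaction_C_of_mem n τ ha, planeCoaction_X_zero,
      planeCoaction_X_one]
    simp only [← map_pow, ← map_mul]
    change AddMonoidAlgebra.single _ _ * AddMonoidAlgebra.single _ _ = _
    rw [AddMonoidAlgebra.single_mul_single, add_zero, map_mul (mk n τ), ← AlgHom.commutes (mk n τ)]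
    rfl
  · simp
  · rw [map_add, map_add, hf, hg, AddMonoidAlgebra.single_add]

/-- The coaction recovers every homogeneous component of a sum, so the sum of the pieces is direct.
They span because each coefficient of a representative is a sum of homogeneous elements. -/
lemma isInternal_grading : DirectSum.IsInternal (grading n τ) := by
  constructor
  · refine (injective_iff_map_eq_zero _).2 fun d hd => ?_
    have h : ∀ (d : DirectSum GradingGroup fun γ => grading n τ γ) (γ : GradingGroup),
        (coaction n τ (DirectSum.coeAddMonoidHom (grading n τ) d)).coeff γ = d γ := by
      intro d γ
      induction d using DirectSum.induction_on with
      | zero => simp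
      | of δ a =>
        rw [DirectSum.coeAddMonoidHom_of, coaction_of_mem n τ a.2, AddMonoidAlgebra.coeff_single,
          Finsupp.single_apply]
        split_ifs with h
        · subst h
          rw [DirectSum.of_eq_same]
        · rw [DirectSum.of_eq_of_ne _ _ _ (Ne.symm h)]
          rfl
      | add d e hd he => simp [hd, he]
    ext γ
    rw [← h, hd]
    simp
  · intro a
    change a ∈ (DirectSum.coeAddMonoidHom (grading n τ)).range
    obtain ⟨f, rfl⟩ := mk_surjective n τ a
    rw [MvPolynomial.as_sum f, map_sum]
    refine sum_mem fun d _ => ?_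
    induction f.coeff d using DirectSum.Decomposition.inductionOn 𝒦 with
    | zero => simp
    | homogeneous c =>
      exact ⟨DirectSum.of _ _ ⟨_, mk_mem_grading n τ (monomial_mem_planeGrading c.2 d)⟩,
        DirectSum.coeAddMonoidHom_of ..⟩
    | add b c hb hc => rw [map_add, map_add]; exact add_mem hb hc

theorem isGradedHopfAlgebra : IsGradedHopfAlgebra 𝒦 (grading n τ) where
  isInternal := isInternal_grading n τ
  gradedMonoid := inferInstance
  algebraMap_mem _ _ ha := algebraMap_mem_grading n τ ha
  comul_mem γ a ha := by
    have h1 : (1 : RussellAlgebra n τ) ∈ grading n τ 0 := SetLike.GradedOne.one_mem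
    refine map_mem_of_mem_grading _ (fun γ a ha => ?_) (comulHom n τ) ?_ ?_ ha
    · rw [Algebra.TensorProduct.algebraMap_apply, ← add_zero γ]
      exact tmul_mem_tensorGrading (algebraMap_mem_grading n τ ha) h1
    · rw [comulHom, lift_x, ← add_zero (0 : GradingGroup)]
      exact add_mem (tmul_mem_tensorGrading (x_mem_grading n τ) h1)
        (tmul_mem_tensorGrading h1 (x_mem_grading n τ))
    · rw [comulHom, lift_y, ← add_zero (0 : GradingGroup)]
      exact add_mem (tmul_mem_tensorGrading (y_mem_grading n τ) h1)
        (tmul_mem_tensorGrading h1 (y_mem_grading n τ))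
  counit_mem γ a ha := by
    refine map_mem_of_mem_grading _ (fun γ a ha => ha) (counitHom n τ) ?_ ?_ ha
    · rw [counitHom, lift_x]; exact zero_mem _
    · rw [counitHom, lift_y]; exact zero_mem _
  antipode_mem γ a ha := by
    refine map_mem_of_mem_grading _ (fun γ a ha => algebraMap_mem_grading n τ ha)
      (antipodeHom n τ) ?_ ?_ ha
    · rw [antipodeHom, lift_x]; exact neg_mem (x_mem_grading n τ)
    · rw [antipodeHom, lift_y]; exact neg_mem (y_mem_grading n τ)

end RussellAlgebra

/-! ### Parametrizations over a field. -/

lemma MvPolynomial.map_aeval_pair {R S S' : Type*} [CommRing R] [CommRing S] [CommRing S']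
    [Algebra R S] [Algebra R S'] (φ : S →ₐ[R] S') (x y : S) (θ : MvPolynomial (Fin 2) R) :
    φ (aeval ![x, y] θ) = aeval ![φ x, φ y] θ := by
  rw [← AlgHom.comp_apply, comp_aeval]
  congr 2
  funext i
  fin_cases i <;> rfl

/-- If `(P, Q)` parametrizes the curve `y ^ pⁿ = ∑ aᵢ x ^ pⁱ` over a field isomorphically, then
some `c ≠ 0` makes all `aᵢ c ^ pⁱ` into `pⁿ`-th powers. -/
theorem exists_mul_pow_eq_pow_of_parametrization {R : Type*} [Field R] {p : ℕ} [hp : Fact p.Prime]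
    [CharP R p] (n m : ℕ) (a : ℕ → R) (h0 : a 0 ≠ 0) (P Q : Polynomial R)
    (hPQ : Q ^ p ^ n = ∑ i ∈ Finset.range (m + 1), a i • P ^ p ^ i)
    (θ : MvPolynomial (Fin 2) R) (hθ : MvPolynomial.aeval ![P, Q] θ = Polynomial.X) :
    ∃ c : R, c ≠ 0 ∧ ∀ i ∈ Finset.range (m + 1), ∃ d, a i * c ^ p ^ i = d ^ p ^ n := by
  let κ := AlgebraicClosure R
  let ι := algebraMap R κ
  have hpκ : (p : κ) = 0 := by rw [← map_natCast ι, CharP.cast_eq_zero, map_zero]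
  have hpκ' : (p : Polynomial κ) = 0 := by rw [← map_natCast Polynomial.C, hpκ, map_zero]
  choose b hb using fun i => IsAlgClosed.exists_pow_nat_eq (ι (a i)) (pow_pos hp.out.pos n)
  have hb0 : IsUnit (b 0) := by
    rw [isUnit_iff_ne_zero]
    intro h
    have h1 := hb 0
    rw [h, zero_pow (pow_ne_zero _ hp.out.ne_zero)] at h1
    exact h0 ((map_eq_zero ι).1 h1.symm)
  obtain ⟨θ', hθ'⟩ := exists_inverse_parametrization hpκ m b hb0 n
  let ψ : Polynomial R →ₐ[R] Polynomial κ := Polynomial.mapAlgHom (Algebra.ofId R κ)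
  have hrel : ψ Q ^ p ^ n = ∑ i ∈ Finset.range (m + 1), b i ^ p ^ n • ψ P ^ p ^ i := by
    rw [← map_pow, hPQ, map_sum]
    refine Finset.sum_congr rfl fun i _ => ?_
    rw [map_smul, map_pow, hb]
    exact (algebraMap_smul κ (a i) _).symm
  obtain ⟨hP, hQ⟩ := (hθ' (Polynomial κ)).2 _ _ hrel
  set w := MvPolynomial.aeval ![ψ P, ψ Q] θ'
  -- `P` and `Q` are polynomials in `w`, and `X` is a polynomial in `P` and `Q`. So `X = g(w)`, and
  -- degrees force `w` to be affine linear.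
  have hX : Polynomial.X ∈ Algebra.adjoin κ {w} := by
    have h1 : ψ Polynomial.X = Polynomial.X := Polynomial.map_X _
    rw [← h1, ← hθ, MvPolynomial.map_aeval_pair]
    have hwm : w ∈ Algebra.adjoin κ {w} := Algebra.self_mem_adjoin_singleton κ w
    have hPm : ψ P ∈ Algebra.adjoin κ {w} := by
      rw [← hP]
      exact pow_mem hwm _
    have hQm : ψ Q ∈ Algebra.adjoin κ {w} := by
      rw [← hQ]
      exact sum_mem fun i _ => Subalgebra.smul_mem _ (pow_mem hwm _) _
    exact MvPolynomial.aeval_pair_mem (B := (Algebra.adjoin κ {w}).toSubring)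
      (fun r => Subalgebra.algebraMap_mem (Algebra.adjoin κ {w}) (ι r)) hPm hQm θ
  rw [Algebra.adjoin_singleton_eq_range_aeval] at hX
  obtain ⟨g, hg⟩ := hX
  have hdeg : w.natDegree = 1 := by
    have h1 := congrArg Polynomial.natDegree hg
    change (g.comp w).natDegree = _ at h1
    rw [Polynomial.natDegree_comp, Polynomial.natDegree_X] at h1
    exact Nat.eq_one_of_mul_eq_one_left h1
  obtain ⟨e, he, f, hef⟩ := Polynomial.natDegree_eq_one.1 hdeg
  have hwpow : ∀ i, w ^ p ^ i =
      Polynomial.monomial (p ^ i) (e ^ p ^ i) + Polynomial.C (f ^ p ^ i) := by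
    intro i
    rw [← hef, add_pow_prime_pow_of_eq_zero hpκ', mul_pow, ← Polynomial.C_pow, ← Polynomial.C_pow,
      Polynomial.C_mul_X_pow_eq_monomial]
  -- Only exponents `p ^ j > 0` are read off, so the constant term `f` of `w` plays no role.
  have hwcoeff : ∀ i j, (w ^ p ^ i).coeff (p ^ j) = if i = j then e ^ p ^ i else 0 := by
    intro i j
    rw [hwpow, Polynomial.coeff_add, Polynomial.coeff_C_of_ne_zero (pow_ne_zero _ hp.out.ne_zero),
      Polynomial.coeff_monomial, add_zero]
    simp only [(Nat.pow_right_injective hp.out.two_le).eq_iff]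
  have hcoeff : ∀ (f : Polynomial R) i, (ψ f).coeff i = ι (f.coeff i) := fun f i =>
    Polynomial.coeff_map _ _
  have hc : ι (P.coeff (p ^ n)) = e ^ p ^ n := by
    rw [← hcoeff, ← hP, hwcoeff, if_pos rfl]
  -- In the closure these are `e ^ pⁿ` and `bᵢ e ^ pⁱ`; as coefficients of `P` and `Q` they lie in
  -- `R`.
  refine ⟨P.coeff (p ^ n), fun h => ?_, fun i hi => ⟨Q.coeff (p ^ i), ι.injective ?_⟩⟩
  · rw [h, map_zero] at hc
    exact pow_ne_zero _ he hc.symm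
  · have hd : ι (Q.coeff (p ^ i)) = b i * e ^ p ^ i := by
      rw [← hcoeff, ← hQ, Polynomial.finsetSum_coeff]
      simp only [Polynomial.coeff_smul, hwcoeff, smul_eq_mul]
      rw [Finset.sum_eq_single_of_mem i hi fun j _ hj => by rw [if_neg hj, mul_zero], if_pos rfl]
    rw [map_mul, map_pow, map_pow, hc, hd, ← hb, mul_pow, ← pow_mul, ← pow_mul, mul_comm (p ^ n)]

/-! ### The field `k_1` and criteria for graded isomorphisms. -/

lemma IsGradedField.isField_degreeOne {k : Type*} [CommRing k]
    {𝒦 : GradingGroup → AddSubgroup k} [GradedRing 𝒦] (hk : IsGradedField 𝒦) :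
    IsField (degreeOne 𝒦) where
  exists_pair_ne := by
    have := hk.nontrivial
    exact exists_pair_ne _
  mul_comm := mul_comm
  mul_inv_cancel {a} ha := by
    obtain ⟨b, hb⟩ := (hk.isUnit 0 a a.2 fun h => ha (Subtype.ext h)).exists_right_inv
    -- The inverse `b` is not known to be homogeneous, but its component of degree `1` is already an
    -- inverse, by comparing components in `a b = 1`.
    refine ⟨⟨DirectSum.decompose 𝒦 b 0, SetLike.coe_mem _⟩, Subtype.ext ?_⟩
    have h := DirectSum.coe_decompose_mul_add_of_left_mem 𝒦 (j := 0) a.2 (b := b)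
    rw [hb, add_zero, DirectSum.decompose_of_mem_same 𝒦 SetLike.GradedOne.one_mem] at h
    exact h.symm

lemma gradedAlgIsomorphic_of_algHom {R A B : Type*} [CommRing R] [CommRing A] [CommRing B]
    [Algebra R A] [Algebra R B] {𝒜 : GradingGroup → AddSubgroup A}
    {ℬ : GradingGroup → AddSubgroup B} (φ : A →ₐ[R] B) (ψ : B →ₐ[R] A)
    (hφψ : φ.comp ψ = AlgHom.id R B) (hψφ : ψ.comp φ = AlgHom.id R A)
    (hφ : ∀ γ, ∀ a ∈ 𝒜 γ, φ a ∈ ℬ γ) (hψ : ∀ γ, ∀ b ∈ ℬ γ, ψ b ∈ 𝒜 γ) :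
    GradedAlgIsomorphic R 𝒜 ℬ := by
  refine ⟨AlgEquiv.ofAlgHom φ ψ hφψ hψφ, fun γ a => ⟨hφ γ a, fun h => ?_⟩⟩
  have h1 := hψ γ _ h
  rwa [show ψ (AlgEquiv.ofAlgHom φ ψ hφψ hψφ a) = a from DFunLike.congr_fun hψφ a] at h1

lemma tensorProduct_lift_mem {k L A S : Type*} [CommRing k] [CommRing L] [CommRing A] [CommRing S]
    [Algebra k L] [Algebra k A] [Algebra k S] [Algebra L S] [IsScalarTower k L S]
    {ℒ : GradingGroup → AddSubgroup L} {𝒜 : GradingGroup → AddSubgroup A}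
    (𝒮 : GradingGroup → AddSubgroup S) [SetLike.GradedMonoid 𝒮]
    (hL : ∀ γ, ∀ a ∈ ℒ γ, algebraMap L S a ∈ 𝒮 γ) (φ : A →ₐ[k] S)
    (hφ : ∀ γ, ∀ a ∈ 𝒜 γ, φ a ∈ 𝒮 γ) {γ : GradingGroup} {z : L ⊗[k] A}
    (hz : z ∈ tensorGrading (R := k) ℒ 𝒜 γ) :
    Algebra.TensorProduct.lift (Algebra.ofId L S) φ (fun _ _ => Commute.all _ _) z ∈ 𝒮 γ := by
  induction hz using AddSubgroup.closure_induction with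
  | zero => rw [map_zero]; exact zero_mem _
  | add _ _ _ _ h1 h2 => rw [map_add]; exact add_mem h1 h2
  | neg _ _ h => rw [map_neg]; exact neg_mem h
  | mem z hz =>
    obtain ⟨i, j, rfl, x, hx, y, hy, rfl⟩ := hz
    rw [Algebra.TensorProduct.lift_tmul]
    exact SetLike.GradedMul.mul_mem (hL i x hx) (hφ j y hy)

/-! ### Triviality over `k` in terms of coefficients. -/

section Russell

variable {k : Type*} [CommRing k] {𝒦 : GradingGroup → AddSubgroup k} [GradedRing 𝒦]
  {p : ℕ} [Fact p.Prime] [CharP (degreeOne 𝒦) p]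

lemma aeval_associatedPolynomial (τ : TwistedPolynomial (degreeOne 𝒦) p) {m : ℕ}
    (hm : ∀ i, i ∉ Finset.range (m + 1) → τ.coeff i = 0) {S : Type*} [CommRing S] [Algebra k S]
    (s : S) : Polynomial.aeval s (associatedPolynomial τ) =
      ∑ i ∈ Finset.range (m + 1), τ.coeff i • s ^ p ^ i := by
  rw [associatedPolynomial, Polynomial.aeval_map_algebraMap, TwistedPolynomial.aeval_toPolynomial τ hm]

namespace RussellAlgebra

variable {n : ℕ} {τ : TwistedPolynomial (degreeOne 𝒦) p}

theorem gradedAlgIsomorphic_of_mul_pow_eq_pow (c : (degreeOne 𝒦)ˣ) (d : ℕ → degreeOne 𝒦)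
    (hd : ∀ i, τ.coeff i * (c : degreeOne 𝒦) ^ p ^ i = d i ^ p ^ n) (hτ : IsUnit (τ.coeff 0)) :
    GradedAlgIsomorphic k (grading n τ) (polyGrading 𝒦 0) := by
  obtain ⟨m, hm⟩ := τ.exists_coeff_eq_zero
  have hd0 : IsUnit (d 0) := by
    rw [← isUnit_pow_iff (pow_ne_zero n (Fact.out : p.Prime).ne_zero), ← hd]
    exact hτ.mul (c.isUnit.pow _)
  obtain ⟨θ, hθ⟩ := exists_inverse_parametrization (CharP.cast_eq_zero (degreeOne 𝒦) p) m d hd0 n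
  have hrel : ∀ {S : Type _} [CommRing S] [Algebra k S] (s : S),
      Polynomial.aeval ((c : degreeOne 𝒦) • s) (associatedPolynomial τ) =
        ∑ i ∈ Finset.range (m + 1), d i ^ p ^ n • s ^ p ^ i := by
    intro S _ _ s
    rw [aeval_associatedPolynomial τ hm]
    refine Finset.sum_congr rfl fun i _ => ?_
    rw [smul_pow, smul_smul, hd]
  let z : Polynomial k := Polynomial.X
  let g : Polynomial k := ∑ i ∈ Finset.range (m + 1), d i • z ^ p ^ i
  let φ : RussellAlgebra n τ →ₐ[k] Polynomial k := lift ((c : degreeOne 𝒦) • z ^ p ^ n) g (by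
    rw [hrel, sum_pow_prime_pow_of_eq_zero (natCast_eq_zero_of_grade_zero 𝒦 p _)]
    refine Finset.sum_congr rfl fun i _ => ?_
    rw [smul_pow, ← pow_mul, ← pow_mul, mul_comm])
  -- In the coordinate `x' = c⁻¹ x` the curve has the coefficients `d i ^ pⁿ`, so the inverse
  -- parametrization applies to `(x', y)`.
  let x' : RussellAlgebra n τ := (↑c⁻¹ : degreeOne 𝒦) • x n τ
  let w : RussellAlgebra n τ := MvPolynomial.aeval ![x', y n τ] θ
  have hx' : (c : degreeOne 𝒦) • x' = x n τ := by
    rw [smul_smul, Units.mul_inv, one_smul]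
  obtain ⟨hw1, hw2⟩ := (hθ (RussellAlgebra n τ)).2 x' (y n τ) (by rw [← hrel, hx', y_pow])
  have hφw : φ w = z := by
    have h := MvPolynomial.map_aeval_pair (φ.restrictScalars (degreeOne 𝒦)) x' (y n τ) θ
    refine h.trans ?_
    rw [map_smul, AlgHom.restrictScalars_apply, AlgHom.restrictScalars_apply]
    simp only [φ, lift_x, lift_y]
    rw [smul_smul, Units.inv_mul, one_smul]
    exact (hθ (Polynomial k)).1 z
  have hw : w ∈ grading n τ 0 := by
    refine aeval_mem_gradeZero _ (fun r : degreeOne 𝒦 => algebraMap_mem_grading n τ r.2) ?_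
      (y_mem_grading n τ) θ
    change _ • _ ∈ _
    rw [Algebra.smul_def]
    exact (SetLike.GradeZero.subring (grading n τ)).mul_mem
      (algebraMap_mem_grading n τ (↑c⁻¹ : degreeOne 𝒦).2) (x_mem_grading n τ)
  refine gradedAlgIsomorphic_of_algHom φ (Polynomial.aeval w) ?_ ?_ ?_ ?_
  · ext
    simp [hφw, z]
  · apply algHom_ext
    · simp only [φ, AlgHom.comp_apply, lift_x, AlgHom.id_apply]
      rw [← AlgHom.restrictScalars_apply (degreeOne 𝒦), map_smul, map_pow]
      simp only [z, AlgHom.restrictScalars_apply, Polynomial.aeval_X]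
      erw [hw1]
      exact hx'
    · simp only [φ, AlgHom.comp_apply, lift_y, AlgHom.id_apply, g]
      rw [← AlgHom.restrictScalars_apply (degreeOne 𝒦), map_sum]
      simp only [map_smul, map_pow, z, AlgHom.restrictScalars_apply, Polynomial.aeval_X]
      exact hw2
  · intro γ a ha
    refine map_mem_of_mem_grading _ (fun γ a ha => algebraMap_mem_polyGrading ha) φ ?_ ?_ ha
    · simp only [φ, lift_x]
      rw [Algebra.smul_def]
      exact (SetLike.GradeZero.subring (polyGrading 𝒦 0)).mul_mem
        (algebraMap_mem_polyGrading (c : degreeOne 𝒦).2) (pow_mem_gradeZero _ X_mem_polyGrading _)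
    · simp only [φ, lift_y]
      exact smul_pow_sum_mem_gradeZero (polyGrading 𝒦 0)
        (fun r : degreeOne 𝒦 => algebraMap_mem_polyGrading (𝒦 := 𝒦) (γ := 0) r.2)
        X_mem_polyGrading _ _ _
  · intro γ f hf
    exact map_mem_of_mem_polyGrading (grading n τ) (fun γ a ha => algebraMap_mem_grading n τ ha) _
      (by rwa [Polynomial.aeval_X]) hf

/-- Homogeneous polynomials of degree `1` have their coefficients in `k_1`. Hence the images of
`T₁`, `T₂` and a representative of the preimage of `T` are defined over `k_1`, and the field case
applies there. -/
theorem exists_mul_pow_eq_pow (hk : IsGradedField 𝒦) (hτ : τ.IsSeparable)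
    (h : GradedAlgIsomorphic k (grading n τ) (polyGrading 𝒦 0)) :
    ∃ c : degreeOne 𝒦, c ≠ 0 ∧ ∀ i, ∃ d, τ.coeff i * c ^ p ^ i = d ^ p ^ n := by
  obtain ⟨e, he⟩ := h
  obtain ⟨m, hm⟩ := τ.exists_coeff_eq_zero
  have hlift : ∀ f ∈ polyGrading 𝒦 0 0,
      ∃ g : Polynomial (degreeOne 𝒦), g.map (algebraMap (degreeOne 𝒦) k) = f := by
    intro f hf
    have h1 : f ∈ Polynomial.lifts (algebraMap (degreeOne 𝒦) k) := by
      rw [Polynomial.lifts_iff_coeff_lifts]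
      intro i
      have h := hf i
      rw [nsmul_zero, sub_zero] at h
      exact ⟨⟨_, h⟩, rfl⟩
    exact Polynomial.mem_lifts _ |>.1 h1
  obtain ⟨P, hP⟩ := hlift _ ((he 0 _).1 (x_mem_grading n τ))
  obtain ⟨Q, hQ⟩ := hlift _ ((he 0 _).1 (y_mem_grading n τ))
  -- The quotient grading is an image, so the preimage of `T` has a representative `q` that is
  -- itself homogeneous of degree `1`.
  obtain ⟨q, hq, hqX⟩ := (he 0 (e.symm Polynomial.X)).2 (by
    rw [AlgEquiv.apply_symm_apply]; exact X_mem_polyGrading)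
  obtain ⟨θ, hθ⟩ : ∃ θ, MvPolynomial.map (algebraMap (degreeOne 𝒦) k) θ = q := by
    change q ∈ Set.range (MvPolynomial.map (algebraMap (degreeOne 𝒦) k))
    rw [MvPolynomial.mem_range_map_iff_coeffs_subset]
    intro a ha
    obtain ⟨d, _, rfl⟩ := MvPolynomial.mem_coeffs_iff.1 ha
    exact ⟨⟨_, hq d⟩, rfl⟩
  let ψ : Polynomial (degreeOne 𝒦) →ₐ[degreeOne 𝒦] Polynomial k :=
    Polynomial.mapAlgHom (Algebra.ofId (degreeOne 𝒦) k)
  have hψ : Function.Injective ψ := Polynomial.map_injective _ Subtype.val_injective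
  have hPQ : Q ^ p ^ n = ∑ i ∈ Finset.range (m + 1), τ.coeff i • P ^ p ^ i := by
    apply hψ
    rw [map_pow, map_sum]
    simp only [map_smul, map_pow]
    have h := relation_map (e : RussellAlgebra n τ →ₐ[k] Polynomial k)
    rw [aeval_associatedPolynomial τ hm] at h
    rw [show ψ P = e (x n τ) from hP, show ψ Q = e (y n τ) from hQ]
    exact h
  have hθX : MvPolynomial.aeval ![P, Q] θ = Polynomial.X := by
    apply hψ
    rw [MvPolynomial.map_aeval_pair, show ψ P = e (x n τ) from hP, show ψ Q = e (y n τ) from hQ,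
      show ψ Polynomial.X = Polynomial.X from Polynomial.map_X _,
      ← MvPolynomial.aeval_map_algebraMap k, hθ]
    have h1 : ((e : RussellAlgebra n τ →ₐ[k] Polynomial k).comp (mk n τ)) =
        MvPolynomial.aeval ![e (x n τ), e (y n τ)] := by
      apply MvPolynomial.algHom_ext
      intro i
      rw [MvPolynomial.aeval_X]
      fin_cases i <;> rfl
    rw [← h1, AlgHom.comp_apply]
    rw [show mk n τ q = e.symm Polynomial.X from hqX]
    exact e.apply_symm_apply _
  let := hk.isField_degreeOne.toField
  obtain ⟨c, hc, hcd⟩ := exists_mul_pow_eq_pow_of_parametrization n m τ.coeff hτ P Q hPQ θ hθX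
  refine ⟨c, hc, fun i => ?_⟩
  by_cases hi : i ∈ Finset.range (m + 1)
  · exact hcd i hi
  · exact ⟨0, by rw [hm i hi, zero_mul, zero_pow (pow_ne_zero _ (Fact.out : p.Prime).ne_zero)]⟩

end RussellAlgebra

end Russell

/-! ### Homogeneous `p`-polynomials, forms over `ℓ`, and perfectness. -/

section Russell

variable {k : Type*} [CommRing k] {𝒦 : GradingGroup → AddSubgroup k} [GradedRing 𝒦]
  {p : ℕ} [Fact p.Prime] [CharP (degreeOne 𝒦) p]

lemma TwistedPolynomial.IsSeparable.isUnit (hk : IsGradedField 𝒦)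
    {τ : TwistedPolynomial (degreeOne 𝒦) p} (hτ : τ.IsSeparable) : IsUnit (τ.coeff 0) := by
  let := hk.isField_degreeOne.toField
  exact isUnit_iff_ne_zero.2 hτ

lemma associatedPolynomial_coeff (τ : TwistedPolynomial (degreeOne 𝒦) p) (i : ℕ) :
    (associatedPolynomial τ).coeff (p ^ i) = τ.coeff i := by
  rw [associatedPolynomial, Polynomial.coeff_map, TwistedPolynomial.coeff_toPolynomial]
  rfl

lemma associatedPolynomial_injective :
    Function.Injective (associatedPolynomial (𝒦 := 𝒦) (p := p)) := by
  intro σ τ h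
  ext i
  rw [← associatedPolynomial_coeff, h, associatedPolynomial_coeff]

lemma associatedPolynomial_eq_sum (τ : TwistedPolynomial (degreeOne 𝒦) p) {m : ℕ}
    (hm : ∀ i, i ∉ Finset.range (m + 1) → τ.coeff i = 0) : associatedPolynomial τ =
      ∑ i ∈ Finset.range (m + 1), Polynomial.monomial (p ^ i) (τ.coeff i : k) := by
  rw [associatedPolynomial, TwistedPolynomial.toPolynomial_eq_sum τ hm, Polynomial.map_sum]
  simp only [Polynomial.map_monomial]
  rfl

variable (𝒦 p) in
theorem isPPolynomial_iff_existsUnique (f : Polynomial k) :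
    (IsPPolynomial p f ∧ f ∈ polyGrading 𝒦 0 0 ∧ f.coeff 1 ≠ 0) ↔
      ∃! τ : TwistedPolynomial (degreeOne 𝒦) p, τ.IsSeparable ∧ associatedPolynomial τ = f := by
  constructor
  · rintro ⟨⟨m, a, rfl⟩, hf, h1⟩
    set f := ∑ i ∈ Finset.range (m + 1), Polynomial.monomial (p ^ i) (a i) with hfdef
    have hf0 : ∀ i, f.coeff i ∈ 𝒦 0 := by
      intro i
      have h := hf i
      rwa [nsmul_zero, sub_zero] at h
    -- The coefficients of `f` are used in place of the `a i`: they lie in `k_1` for every `i`,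
    -- whereas `a i` is arbitrary for `i > m`.
    let τ : TwistedPolynomial (degreeOne 𝒦) p := ∑ i ∈ Finset.range (m + 1),
      TwistedPolynomial.C ⟨f.coeff (p ^ i), hf0 _⟩ * TwistedPolynomial.F ^ i
    have hcoeff : ∀ i, τ.coeff i = ⟨f.coeff (p ^ i), hf0 _⟩ := by
      intro i
      rw [TwistedPolynomial.coeff_sum_C_mul_F_pow
        (a := fun i => (⟨f.coeff (p ^ i), hf0 _⟩ : degreeOne 𝒦))]
      split_ifs with hi
      · rfl
      · refine Subtype.ext ?_
        change 0 = f.coeff (p ^ i)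
        rw [hfdef, Polynomial.coeff_sum_monomial_pow, if_neg hi]
    have hτ : associatedPolynomial τ = f := by
      rw [associatedPolynomial_eq_sum τ (m := m)]
      · refine Finset.sum_congr rfl fun i hi => ?_
        rw [hcoeff]
        change Polynomial.monomial (p ^ i) (f.coeff (p ^ i)) = _
        rw [hfdef, Polynomial.coeff_sum_monomial_pow, if_pos hi]
      · intro i hi
        rw [hcoeff]
        refine Subtype.ext ?_
        change f.coeff (p ^ i) = 0
        rw [hfdef, Polynomial.coeff_sum_monomial_pow, if_neg hi]
    refine ⟨τ, ⟨fun h => h1 ?_, hτ⟩, fun σ hσ => associatedPolynomial_injective (hσ.2.trans hτ.symm)⟩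
    have h2 := associatedPolynomial_coeff τ 0
    rwa [h, hτ, pow_zero] at h2
  · rintro ⟨τ, ⟨hτ, rfl⟩, -⟩
    obtain ⟨m, hm⟩ := τ.exists_coeff_eq_zero
    refine ⟨⟨m, fun i => τ.coeff i, associatedPolynomial_eq_sum τ hm⟩, fun i => ?_, fun h => hτ ?_⟩
    · rw [nsmul_zero, sub_zero, associatedPolynomial, Polynomial.coeff_map]
      exact (τ.toPolynomial.coeff i).2
    · rw [← pow_zero p, associatedPolynomial_coeff] at h
      exact Subtype.ext h

namespace RussellAlgebra

variable {n : ℕ} {τ : TwistedPolynomial (degreeOne 𝒦) p}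

/-- `A(τ)` becomes trivial over every graded extension that contains `pⁿ`-th roots, homogeneous of
degree `1`, of the coefficients of `τ`. -/
theorem isGradedForm_of_pow_eq.{u, v} {k : Type u} [CommRing k]
    {𝒦 : GradingGroup → AddSubgroup k} [GradedRing 𝒦] {p : ℕ} [Fact p.Prime]
    [CharP (degreeOne 𝒦) p] {n : ℕ} {τ : TwistedPolynomial (degreeOne 𝒦) p}
    (hτ : IsUnit (τ.coeff 0)) {L : Type v} [CommRing L] [Algebra k L]
    (ℒ : GradingGroup → AddSubgroup L) [SetLike.GradedMonoid ℒ]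
    (hL : ∀ γ, ∀ a ∈ 𝒦 γ, algebraMap k L a ∈ ℒ γ) (b : ℕ → L) (hb : ∀ i, b i ∈ ℒ 0)
    (hbτ : ∀ i, b i ^ p ^ n = algebraMap k L (τ.coeff i)) :
    IsGradedForm (k := k) ℒ (grading n τ) (polyGrading 𝒦 0) := by
  obtain ⟨m, hm⟩ := τ.exists_coeff_eq_zero
  -- Working over the degree-`1` subring of `L` gives `θ` coefficients of degree `1`, which makes
  -- `w` below homogeneous. This ring need not be a field; `β 0` is a unit because its `pⁿ`-th power
  -- is the image of the unit `a₀`.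
  let R := SetLike.GradeZero.subring ℒ
  let β : ℕ → R := fun i => ⟨b i, hb i⟩
  have hR : (p : R) = 0 := Subtype.ext (natCast_eq_zero_of_grade_zero 𝒦 p L)
  have hβ0 : IsUnit (β 0) := by
    rw [← isUnit_pow_iff (pow_ne_zero n (Fact.out : p.Prime).ne_zero)]
    let ι : degreeOne 𝒦 →+* R := ((algebraMap k L).comp (degreeOne 𝒦).subtype).codRestrict R
      fun a => hL 0 a a.2
    convert hτ.map ι
    exact Subtype.ext (hbτ 0)
  -- The same `θ` is evaluated in `L ⊗ A(τ)` and in `L ⊗ k[T]`, both in universe `max u v`.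
  obtain ⟨θ, hθ⟩ := exists_inverse_parametrization.{v, max u v} hR m β hβ0 n
  have hrel : ∀ {S : Type (max u v)} [CommRing S] [Algebra k S] [Algebra L S] [IsScalarTower k L S]
      (s : S), Polynomial.aeval s (associatedPolynomial τ) =
        ∑ i ∈ Finset.range (m + 1), β i ^ p ^ n • s ^ p ^ i := by
    intro S _ _ _ _ s
    rw [aeval_associatedPolynomial τ hm]
    refine Finset.sum_congr rfl fun i _ => ?_
    change (τ.coeff i : k) • s ^ p ^ i = (b i ^ p ^ n) • s ^ p ^ i
    rw [hbτ, algebraMap_smul]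
  let 𝒰 := tensorGrading (R := k) ℒ (grading n τ)
  let 𝒱 := tensorGrading (R := k) ℒ (polyGrading 𝒦 0)
  have h1L : (1 : L) ∈ ℒ 0 := SetLike.GradedOne.one_mem
  have hmem𝒰 : ∀ {γ} {a : RussellAlgebra n τ}, a ∈ grading n τ γ → (1 : L) ⊗ₜ[k] a ∈ 𝒰 γ := by
    intro γ a ha
    rw [← zero_add γ]
    exact tmul_mem_tensorGrading h1L ha
  have hL𝒰 : ∀ γ, ∀ l ∈ ℒ γ, algebraMap L (L ⊗[k] RussellAlgebra n τ) l ∈ 𝒰 γ := by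
    intro γ l hl
    rw [← add_zero γ]
    exact tmul_mem_tensorGrading hl SetLike.GradedOne.one_mem
  have hL𝒱 : ∀ γ, ∀ l ∈ ℒ γ, algebraMap L (L ⊗[k] Polynomial k) l ∈ 𝒱 γ := by
    intro γ l hl
    rw [← add_zero γ]
    exact tmul_mem_tensorGrading hl SetLike.GradedOne.one_mem
  let z : L ⊗[k] Polynomial k := 1 ⊗ₜ Polynomial.X
  have hz : z ∈ 𝒱 0 := by
    rw [← zero_add (0 : GradingGroup)]
    exact tmul_mem_tensorGrading h1L X_mem_polyGrading
  let g : L ⊗[k] Polynomial k := ∑ i ∈ Finset.range (m + 1), β i • z ^ p ^ i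
  let φ₀ : RussellAlgebra n τ →ₐ[k] L ⊗[k] Polynomial k := lift (z ^ p ^ n) g (by
    rw [hrel, sum_pow_prime_pow_of_eq_zero (natCast_eq_zero_of_grade_zero 𝒦 p _)]
    refine Finset.sum_congr rfl fun i _ => ?_
    rw [smul_pow, ← pow_mul, ← pow_mul, mul_comm]
    rfl)
  let x' : L ⊗[k] RussellAlgebra n τ := 1 ⊗ₜ x n τ
  let y' : L ⊗[k] RussellAlgebra n τ := 1 ⊗ₜ y n τ
  have hxy : y' ^ p ^ n = Polynomial.aeval x' (associatedPolynomial τ) :=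
    relation_map (Algebra.TensorProduct.includeRight :
      RussellAlgebra n τ →ₐ[k] L ⊗[k] RussellAlgebra n τ)
  rw [hrel] at hxy
  obtain ⟨hw1, hw2⟩ := (hθ (L ⊗[k] RussellAlgebra n τ)).2 x' y' hxy
  set w : L ⊗[k] RussellAlgebra n τ := MvPolynomial.aeval ![x', y'] θ
  have hw : w ∈ 𝒰 0 := aeval_mem_gradeZero 𝒰 (fun r : R => hL𝒰 0 r r.2)
    (hmem𝒰 (x_mem_grading n τ)) (hmem𝒰 (y_mem_grading n τ)) θ
  let ψ₀ : Polynomial k →ₐ[k] L ⊗[k] RussellAlgebra n τ := Polynomial.aeval w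
  let φ : L ⊗[k] RussellAlgebra n τ →ₐ[L] L ⊗[k] Polynomial k :=
    Algebra.TensorProduct.lift (Algebra.ofId L _) φ₀ fun _ _ => Commute.all _ _
  let ψ : L ⊗[k] Polynomial k →ₐ[L] L ⊗[k] RussellAlgebra n τ :=
    Algebra.TensorProduct.lift (Algebra.ofId L _) ψ₀ fun _ _ => Commute.all _ _
  have hφ : ∀ a, φ (1 ⊗ₜ a) = φ₀ a := fun a => by
    rw [Algebra.TensorProduct.lift_tmul, map_one, one_mul]
  have hψ : ∀ a, ψ (1 ⊗ₜ a) = ψ₀ a := fun a => by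
    rw [Algebra.TensorProduct.lift_tmul, map_one, one_mul]
  have hφw : φ w = z := by
    have h := MvPolynomial.map_aeval_pair (φ.restrictScalars R) x' y' θ
    refine h.trans ?_
    rw [AlgHom.restrictScalars_apply, AlgHom.restrictScalars_apply, hφ, hφ, lift_x, lift_y]
    exact (hθ _).1 z
  have hψz : ψ z = w := by rw [hψ, Polynomial.aeval_X]
  refine gradedAlgIsomorphic_of_algHom φ ψ ?_ ?_ ?_ ?_
  · refine Algebra.TensorProduct.ext (Subsingleton.elim _ _) (Polynomial.algHom_ext ?_)
    change φ (ψ z) = z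
    rw [hψz, hφw]
  · refine Algebra.TensorProduct.ext (Subsingleton.elim _ _) (algHom_ext ?_ ?_)
    · change ψ (φ (1 ⊗ₜ x n τ)) = x'
      rw [hφ, lift_x, map_pow, hψz, hw1]
    · change ψ (φ (1 ⊗ₜ y n τ)) = y'
      rw [hφ, lift_y]
      change ψ.restrictScalars R g = y'
      simp only [g, map_sum, map_smul, map_pow, AlgHom.restrictScalars_apply, hψz]
      exact hw2
  · intro γ a ha
    refine tensorProduct_lift_mem 𝒱 hL𝒱 φ₀ (fun δ a ha => ?_) ha
    refine map_mem_of_mem_grading 𝒱 (fun γ a ha => ?_) φ₀ ?_ ?_ ha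
    · rw [IsScalarTower.algebraMap_apply k L]
      exact hL𝒱 γ _ (hL γ a ha)
    · rw [lift_x]
      exact pow_mem_gradeZero 𝒱 hz _
    · rw [lift_y]
      exact smul_pow_sum_mem_gradeZero 𝒱 (fun r : R => hL𝒱 0 r r.2) hz _ _ _
  · intro γ f hf
    refine tensorProduct_lift_mem 𝒰 hL𝒰 ψ₀ (fun δ f hf => ?_) hf
    refine map_mem_of_mem_polyGrading 𝒰 (fun γ a ha => ?_) ψ₀ ?_ hf
    · rw [IsScalarTower.algebraMap_apply k L]
      exact hL𝒰 γ _ (hL γ a ha)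
    · rwa [Polynomial.aeval_X]

theorem isGradedForm (hτ : IsUnit (τ.coeff 0)) {K : Type*} [CommRing K] [Algebra k K]
    (𝒦' : GradingGroup → AddSubgroup K) [GradedRing 𝒦'] (hK : IsGradedAlgClosure 𝒦 𝒦') :
    IsGradedForm (k := k) (subalgebraGrading 𝒦' (rootExtension 𝒦 p n K)) (grading n τ)
      (polyGrading 𝒦 0) := by
  have := hK.isGradedField.nontrivial
  have hroot : ∀ i, ∃ b ∈ 𝒦' 0, b ^ p ^ n = algebraMap k K (τ.coeff i) := by
    intro i
    have hpos : 0 < p ^ n := pow_pos (Fact.out : p.Prime).pos n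
    -- `X ^ pⁿ - aᵢ` is homogeneous when `X` has degree `1`, so it has a root of degree `1`. The
    -- root lies in `ℓ` because its `pⁿ`-th power is `aᵢ`.
    obtain ⟨b, hb, hroot⟩ := hK.exists_root 0 0
      (Polynomial.X ^ p ^ n - Polynomial.C (algebraMap k K (τ.coeff i)))
      (sub_mem (pow_mem_gradeZero _ X_mem_polyGrading _)
        (algebraMap_mem_polyGrading (hK.algebraMap_mem 0 _ (τ.coeff i).2)))
      (by rwa [Polynomial.natDegree_X_pow_sub_C])
    refine ⟨b, hb, ?_⟩
    simpa [sub_eq_zero] using hroot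
  choose b hb hbτ using hroot
  exact isGradedForm_of_pow_eq hτ _ (fun γ a ha => hK.algebraMap_mem γ a ha)
    (fun i => ⟨b i, _, (hbτ i).symm⟩) hb fun i => Subtype.ext (hbτ i)

theorem gradedAlgIsomorphic_iff (hk : IsGradedField 𝒦) (hτ : τ.IsSeparable) :
    GradedAlgIsomorphic k (grading n τ) (polyGrading 𝒦 0) ↔
      ∃ (c : (degreeOne 𝒦)ˣ) (σ : TwistedPolynomial (degreeOne 𝒦) p),
        τ * TwistedPolynomial.C (c : degreeOne 𝒦) = σ.frobeniusTwist n := by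
  constructor
  · intro h
    obtain ⟨c, hc, hcd⟩ := exists_mul_pow_eq_pow hk hτ h
    choose d hd using hcd
    obtain ⟨m, hm⟩ := τ.exists_coeff_eq_zero
    have hcu : IsUnit c := by
      let := hk.isField_degreeOne.toField
      exact isUnit_iff_ne_zero.2 hc
    obtain ⟨u, rfl⟩ := hcu
    refine ⟨u, ∑ i ∈ Finset.range (m + 1), TwistedPolynomial.C (d i) * TwistedPolynomial.F ^ i, ?_⟩
    ext1 i
    rw [TwistedPolynomial.coeff_mul_C, TwistedPolynomial.coeff_frobeniusTwist,
      TwistedPolynomial.coeff_sum_C_mul_F_pow]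
    split_ifs with hi
    · exact hd i
    · rw [hm i hi, zero_mul, zero_pow (pow_ne_zero _ (Fact.out : p.Prime).ne_zero)]
  · rintro ⟨c, σ, h⟩
    refine gradedAlgIsomorphic_of_mul_pow_eq_pow c σ.coeff (fun i => ?_) (hτ.isUnit hk)
    rw [← TwistedPolynomial.coeff_mul_C, h, TwistedPolynomial.coeff_frobeniusTwist]

theorem perfectRing_iff_forall_gradedAlgIsomorphic (hk : IsGradedField 𝒦) (hn : 1 ≤ n) :
    PerfectRing (degreeOne 𝒦) p ↔
      ∀ τ : TwistedPolynomial (degreeOne 𝒦) p, τ.IsSeparable →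
        GradedAlgIsomorphic k (grading n τ) (polyGrading 𝒦 0) := by
  constructor
  · intro _ τ hτ
    choose d hd using fun i => (bijective_iterateFrobenius (degreeOne 𝒦) p n).2 (τ.coeff i)
    refine gradedAlgIsomorphic_of_mul_pow_eq_pow 1 d (fun i => ?_) (hτ.isUnit hk)
    rw [Units.val_one, one_pow, mul_one, ← hd, iterateFrobenius_def]
  · intro h
    have := hk.isField_degreeOne.isDomain
    refine PerfectRing.ofSurjective _ p fun a => ?_
    -- The test element is `τ = 1 + a F`. Triviality gives `c = d ^ pⁿ` and `a c ^ p = e ^ pⁿ`, so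
    -- `a = (e / d ^ p) ^ pⁿ`.
    let a' : ℕ → degreeOne 𝒦 := fun i => if i = 0 then 1 else a
    let τ : TwistedPolynomial (degreeOne 𝒦) p :=
      ∑ i ∈ Finset.range 2, TwistedPolynomial.C (a' i) * TwistedPolynomial.F ^ i
    have h0 : τ.coeff 0 = 1 := by
      rw [TwistedPolynomial.coeff_sum_C_mul_F_pow]; rfl
    have h1 : τ.coeff 1 = a := by
      rw [TwistedPolynomial.coeff_sum_C_mul_F_pow]; rfl
    have hτ : τ.IsSeparable := by
      rw [TwistedPolynomial.IsSeparable, h0]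
      exact one_ne_zero
    obtain ⟨c, hc, hcd⟩ := exists_mul_pow_eq_pow hk hτ (h τ hτ)
    obtain ⟨d, hd⟩ := hcd 0
    obtain ⟨e, he⟩ := hcd 1
    rw [h0, one_mul, pow_zero, pow_one] at hd
    rw [h1, pow_one, hd] at he
    let := hk.isField_degreeOne.toField
    have hd0 : d ≠ 0 := by
      rintro rfl
      exact hc (hd.trans (zero_pow (pow_ne_zero _ (Fact.out : p.Prime).ne_zero)))
    obtain ⟨r, rfl⟩ := Nat.exists_eq_add_of_le' hn
    -- Here `r = n - 1`: since `n ≥ 1`, a `pⁿ`-th power is a `p`-th power.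
    refine ⟨(e / d ^ p) ^ p ^ r, ?_⟩
    rw [frobenius_def, ← pow_mul, ← pow_succ, div_pow, ← he, ← pow_mul, ← pow_mul,
      mul_comm p, mul_div_cancel_right₀ _ (pow_ne_zero _ hd0)]

end RussellAlgebra

end Russell

theorem mainTheorem3 {k : Type*} [CommRing k] (𝒦 : GradingGroup → AddSubgroup k) [GradedRing 𝒦]
    (hk : IsGradedField 𝒦) (p : ℕ) [Fact p.Prime] [CharP (degreeOne 𝒦) p]
    {K : Type*} [CommRing K] [Algebra k K] (𝒦' : GradingGroup → AddSubgroup K) [GradedRing 𝒦']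
    (hK : IsGradedAlgClosure 𝒦 𝒦') (n : ℕ) (hn : 1 ≤ n) :
    -- the homogeneous `p`-polynomials of degree `1` with `a₀ ≠ 0` are the `τ(T)`
    (∀ f : Polynomial k,
      (IsPPolynomial p f ∧ f ∈ polyGrading 𝒦 0 0 ∧ f.coeff 1 ≠ 0) ↔
        ∃! τ : TwistedPolynomial (degreeOne 𝒦) p, τ.IsSeparable ∧ associatedPolynomial τ = f) ∧
    (∀ τ : TwistedPolynomial (degreeOne 𝒦) p, τ.IsSeparable →
      IsGradedHopfAlgebra 𝒦 (RussellAlgebra.grading n τ) ∧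
      IsGradedForm (k := k) (subalgebraGrading 𝒦' (rootExtension 𝒦 p n K))
        (RussellAlgebra.grading n τ) (polyGrading 𝒦 0) ∧
      (GradedAlgIsomorphic k (RussellAlgebra.grading n τ) (polyGrading 𝒦 0) ↔
        ∃ (c : (degreeOne 𝒦)ˣ) (σ : TwistedPolynomial (degreeOne 𝒦) p),
          τ * TwistedPolynomial.C (c : degreeOne 𝒦) = σ.frobeniusTwist n)) ∧
    (PerfectRing (degreeOne 𝒦) p ↔
      ∀ τ : TwistedPolynomial (degreeOne 𝒦) p, τ.IsSeparable →
        GradedAlgIsomorphic k (RussellAlgebra.grading n τ) (polyGrading 𝒦 0)) := by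
  refine ⟨isPPolynomial_iff_existsUnique 𝒦 p, fun τ hτ => ⟨RussellAlgebra.isGradedHopfAlgebra n τ,
    RussellAlgebra.isGradedForm (hτ.isUnit hk) 𝒦' hK,
    RussellAlgebra.gradedAlgIsomorphic_iff hk hτ⟩,
    RussellAlgebra.perfectRing_iff_forall_gradedAlgIsomorphic hk hn⟩
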